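/- Consider the Riccati equation $$\frac{du}{d\tau}=b(\tau)-a(\tau)u^2,\qquad a(\tau)=\frac{(\sqrt2+1)\tau+2}{4\tau(\tau+1)},\quad b(\tau)=\frac{(\sqrt2-1)\tau-2}{4\tau(\tau+1)},\qquad \tau>0. \tag{R}$$ Put $\tau=4r^2$ with $r>0$, $u_1=\tan\frac{\pi}{8}=\sqrt2-1$ and $u_2=-u_1$. For $C\in\mathbb R$ put $D=\frac12\bigl[\sqrt2(\sqrt2-1)+(\sqrt2+1)C^2\bigr]$, and say that a solution $u$ defined near infinity has expansion $(E_C)$ if $$u=\sqrt2-1+\frac{C}{r}+\frac{D}{r^2}+O\Bigl(\frac1{r^3}\Bigr)\qquad(r\to\infty).\tag{$E_C$}$$ 1. On every interval contained in $(0,2(\sqrt2+1))$, every solution of (R) is strictly decreasing. 2. Every solution of (R) on a half-line $[\tau_1,\infty)$, $\tau_1>0$, with $u\to u_1$ as $\tau\to\infty$ has expansion $(E_C)$ for exactly one $C\in\mathbb R$. Conversely, for every $C\in\mathbb R$ there is a solution on some half-line $[\tau_1,\infty)$, $\tau_1>0$, with expansion $(E_C)$, and any two such solutions (for the same $C$)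 coincide on the intersection of their half-lines. Now let $\delta_0>0$ be arbitrary, $\tau_0=2(\sqrt2+1)+\delta_0$, $D_1=\{(\tau,u):\tau\ge\tau_0,\ 0\le u\le u_1\}$ and $D_2=\{(\tau,u):\tau\ge\tau_0,\ u_2\le u\le0\}$. Through every point $(\tau_1,y)$ with $\tau_1\ge\tau_0$ there passes a solution of (R) on a maximal right interval of existence $[\tau_1,T)$, $\tau_1<T\le\infty$. There are solutions $\psi_2$ and $\psi_1^*$ of (R) on $[\tau_0,\infty)$ with the following properties. 3. The graph of $\psi_2$ lies in $D_2$, $\psi_2>u_2$, $\psi_2(\tau)\to u_2$ as $\tau\to\infty$, and $$\psi_2(\tau)=1-\sqrt2+\frac{2\sqrt2(\sqrt2-1)}{3\tau}+O\Bigl(\frac1{\tau^2}\Bigr).$$ Among the solutions on $[\tau_0,\infty)$, $\psi_2$ is the only one that is unstable (not Lyapunov stable), the only one that tends to $u_2$, and the only one whose graph lies in $D_2$. 4. Every solution on a maximal right interval $[\tau_1,T)$, $\tau_1\ge\tau_0$, with $u(\tau_1)>\psi_2(\tau_1)$ has $T=\infty$, stays above $\psi_2$, and tends to $u_1$ as $\tau\to\infty$.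 5. Every solution on a maximal right interval $[\tau_1,T)$, $\tau_1\ge\tau_0$, with $u(\tau_1)<\psi_2(\tau_1)$ has $T<\infty$; on $[\tau_1,T)$ it is strictly decreasing and the distance $\psi_2-u$ is strictly increasing, and $u(\tau)\to-\infty$ as $\tau\to T^-$. 6. Infinitely many solutions on $[\tau_0,\infty)$ have their graph in $D_1$, are strictly increasing on $[\tau_0,\infty)$, tend to $u_1$, and have expansion $(E_C)$ with some $C<0$. 7. $\psi_1^*>u_1$ on $[\tau_0,\infty)$, and $\psi_1^*$ is strictly decreasing and tends to $u_1$; it satisfies $$\psi_1^*(\tau)=\sqrt2-1+\frac{2\sqrt2(\sqrt2-1)}{\tau}+O\Bigl(\frac1{\tau^2}\Bigr),$$ and it has expansion $(E_0)$. 8. Infinitely many solutions $u$ on $[\tau_0,\infty)$ satisfy $u>\psi_1^*$ on $[\tau_0,\infty)$, tend to $u_1$, and have expansion $(E_C)$ with some $C>0$. 9. Let $u$ be a solution on $[\tau_1,\infty)$, $\tau_1\ge\tau_0$, with expansion $(E_C)$. Then $C<0$ if and only if the graph of $u$ lies in $D_1$ for all large $\tau$, and in this case $u$ is strictly increasing for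 all large $\tau$; $C=0$ if and only if $u=\psi_1^*$ on $[\tau_1,\infty)$; and $C>0$ if and only if $u>\psi_1^*$ on $[\tau_1,\infty)$. -/

import Mathlib

open Set Filter Topology Asymptotics

namespace SpiralRiccati

/-- The coefficient `a(τ)` of the Riccati equation `u' = b(τ) - a(τ) u²`. -/
noncomputable def coeffA (τ : ℝ) : ℝ :=
  ((√2 + 1) * τ + 2) / (4 * τ * (τ + 1))

/-- The coefficient `b(τ)` of the Riccati equation `u' = b(τ) - a(τ) u²`. -/
noncomputable def coeffB (τ : ℝ) : ℝ :=
  ((√2 - 1) * τ - 2) / (4 * τ * (τ + 1))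

/-- `u` solves `u' = b(τ) - a(τ) u²` on the set `J` (in practice an interval of positive reals;
one-sided derivatives are taken at the end points that belong to `J`). -/
def IsSolutionOn (u : ℝ → ℝ) (J : Set ℝ) : Prop :=
  ∀ τ ∈ J, HasDerivWithinAt u (coeffB τ - coeffA τ * u τ ^ 2) J τ

/-- The interval `[τ₁, T)`, where `T` is a real number or `+∞`. -/
def forwardInterval (τ₁ : ℝ) (T : WithTop ℝ) : Set ℝ :=
  {τ : ℝ | τ₁ ≤ τ ∧ (τ : WithTop ℝ) < T}

/-- `u` is a solution on `[τ₁, T)`, `τ₁ < T ≤ +∞`, that cannot be extended to the right as a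
solution: `[τ₁, T)` is its maximal right interval of existence. -/
structure IsMaximalSolution (u : ℝ → ℝ) (τ₁ : ℝ) (T : WithTop ℝ) : Prop where
  lt : (τ₁ : WithTop ℝ) < T
  isSolutionOn : IsSolutionOn u (forwardInterval τ₁ T)
  maximal : ∀ (T' : WithTop ℝ) (v : ℝ → ℝ), T < T' →
    IsSolutionOn v (forwardInterval τ₁ T') → ¬ EqOn v u (forwardInterval τ₁ T)

/-- Lyapunov stability of a solution `ψ` on `[τ₀, ∞)`. -/
def IsLyapunovStable (ψ : ℝ → ℝ) (τ₀ : ℝ) : Prop :=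
  ∀ ε > 0, ∃ δ > 0, ∀ y : ℝ, |y - ψ τ₀| < δ →
    ∃ v : ℝ → ℝ, IsSolutionOn v (Ici τ₀) ∧ v τ₀ = y ∧ ∀ τ ≥ τ₀, |v τ - ψ τ| < ε

/-- The coefficient `D` of `1 / r²`, as a function of the coefficient `C` of `1 / r`. -/
noncomputable def coeffD (C : ℝ) : ℝ :=
  1 / 2 * (√2 * (√2 - 1) + (√2 + 1) * C ^ 2)

/-- With `τ = 4 r²`, `u = √2 - 1 + C / r + D / r² + O(1 / r³)` as `r → ∞`. -/
def HasExpansion (u : ℝ → ℝ) (C : ℝ) : Prop :=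
  (fun r : ℝ => u (4 * r ^ 2) - (√2 - 1 + C / r + coeffD C / r ^ 2))
    =O[atTop] fun r : ℝ => 1 / r ^ 3

end SpiralRiccati

/-!
The quotient `u = p / q` of a solution of the linear system `p' = b q`, `q' = a p` solves the
Riccati equation `u' = b - a u²`, and every solution arises in this way
(`IsLinSol.eq_mul_of_isSolutionOn`). The linear system is Fuchsian, and infinity is a regular
singular point with exponents `± 1 / 4`. Their difference is not an integer, so there are two
Frobenius solutions: `τ ^ (σ / 4)`, `σ = ± 1`, times power series in `1 / τ`. The recurrence for the
coefficients shows that they are at most `2 ^ n`, hence the series converge for `τ > 2`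
(`isLinSol_frob`). Consequently all solutions of the linear system are known explicitly on
`(2, ∞)`, and no existence theorem for differential equations is needed; poles of `u` are zeros
of `q`.

The dominant Frobenius solution (`σ = 1`) gives `ψ₁*` and the recessive one (`σ = -1`) gives `ψ₂`.
Subtracting `(√2 + 1) C` times the recessive solution from the dominant one gives the solution
with expansion parameter `C` (`hasExpansion_fam`), and apart from `ψ₂` these are all solutions near
infinity (`IsSolutionOn.recessive_or_fam`). Hence a solution defined up to infinity either equals
`ψ₂` or tends to `tan (π / 8)` with an expansion.

The global shape comes from monotone quantities. The quadratic form
`growth = 4 (τ + 1) (b q² - a p²)` has the sign of `u'`, and its derivative is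
`2 (p² + q²) / τ² > 0` (`IsLinSol.hasDerivAt_growth`). It tends to zero along both Frobenius
solutions, so it is negative there and `ψ₁*`, `ψ₂` decrease (`growth_frob_neg`); a solution that
increases once increases from then on (`IsSolutionOn.strictMonoOn_of_rhs_pos`). The product `p q` of
the recessive solution increases to zero, so `ψ₂` is negative and has no poles
(`frobP_mul_frobQ_neg`). For a solution above `ψ₂` the quotient of `q` by its recessive counterpart
increases (`IsLinSol.div_frobQ_le`), so `q` stays positive and the solution is global; a global
solution below `ψ₂` would have to tend to `tan (π / 8)`, which is impossible
(`IsSolutionOn.psi_le`). Stability follows from an explicit formula for the difference of two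
solutions (`IsSolutionOn.isLyapunovStable`).
-/

namespace SpiralRiccati

/-! ### Power series with coefficients of size at most `2 ^ n` -/

lemma hasSum_of_abs_le_two_pow {c : ℕ → ℝ} (hc : ∀ n, |c n| ≤ 2 ^ n) {x : ℝ} (hx : |x| < 1 / 2) :
    HasSum (fun n => c n * x ^ n) (∑' n, c n * x ^ n) := by
  refine Summable.hasSum ?_
  have h2 : |2 * x| < 1 := by rw [abs_mul, abs_two]; linarith
  refine Summable.of_norm_bounded (summable_geometric_of_lt_one (abs_nonneg _) h2) fun n => ?_
  rw [Real.norm_eq_abs, abs_mul, abs_mul, abs_pow, mul_pow, abs_two]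
  exact mul_le_mul_of_nonneg_right (hc n) (by positivity)

lemma hasDerivAt_tsum_of_abs_le_two_pow {c : ℕ → ℝ} (hc : ∀ n, |c n| ≤ 2 ^ n) {x : ℝ}
    (hx : |x| < 1 / 2) :
    ∃ F', HasDerivAt (fun y => ∑' n, c n * y ^ n) F' x ∧
      HasSum (fun n : ℕ => ((n : ℝ) + 1) * c (n + 1) * x ^ n) F' := by
  set ρ : ℝ := (|x| + 1 / 2) / 2 with hρ
  have hρ0 : 0 < ρ := by positivity
  have hxρ : |x| < ρ := by linarith
  have hρ1 : 2 * ρ < 1 := by linarith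
  have hu : Summable fun n : ℕ => (n : ℝ) * 2 ^ n * ρ ^ (n - 1) := by
    rw [← summable_nat_add_iff 1]
    have h1 : Summable fun n : ℕ => (n : ℝ) ^ 1 * (2 * ρ) ^ n :=
      summable_pow_mul_geometric_of_norm_lt_one 1 (by
        rw [Real.norm_eq_abs, abs_of_pos (by positivity)]; exact hρ1)
    have h2 : Summable fun n : ℕ => (2 * ρ) ^ n :=
      summable_geometric_of_lt_one (by positivity) hρ1
    refine ((h1.add h2).mul_left 2).congr fun n => ?_
    rw [Nat.add_sub_cancel, mul_pow]
    push_cast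
    ring
  have hbd : ∀ (n : ℕ) (y : ℝ), y ∈ Ioo (-ρ) ρ →
      ‖c n * ((n : ℝ) * y ^ (n - 1))‖ ≤ (n : ℝ) * 2 ^ n * ρ ^ (n - 1) := by
    intro n y hy
    rw [Real.norm_eq_abs, abs_mul, abs_mul, abs_pow, Nat.abs_cast]
    have hy' : |y| ≤ ρ := (abs_lt.2 hy).le
    calc |c n| * ((n : ℝ) * |y| ^ (n - 1)) ≤ 2 ^ n * ((n : ℝ) * ρ ^ (n - 1)) := by
          gcongr
          exact hc n
      _ = _ := by ring
  have hxm : x ∈ Ioo (-ρ) ρ := abs_lt.1 hxρ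
  have hder := hasDerivAt_tsum_of_isPreconnected (y₀ := x) hu isOpen_Ioo isPreconnected_Ioo
    (fun n y _ => (hasDerivAt_pow n y).const_mul (c n)) hbd hxm
    (hasSum_of_abs_le_two_pow hc hx).summable hxm
  refine ⟨_, hder, ?_⟩
  have hs : Summable fun n : ℕ => c n * ((n : ℝ) * x ^ (n - 1)) :=
    Summable.of_norm_bounded hu fun n => hbd n x hxm
  have h0 := hs.hasSum
  rw [← hasSum_nat_add_iff' 1] at h0
  simp only [Finset.sum_range_one, Nat.cast_zero, zero_mul, mul_zero, sub_zero] at h0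
  refine h0.congr_fun ?_ |> fun h => h
  intro n
  rw [Nat.add_sub_cancel]
  push_cast
  ring

lemma abs_tsum_sub_le_of_abs_le_two_pow {c : ℕ → ℝ} (hc : ∀ n, |c n| ≤ 2 ^ n) {x : ℝ}
    (h0 : 0 ≤ x) (hx : x < 1 / 2) :
    |(∑' n, c n * x ^ n) - (c 0 + c 1 * x)| ≤ 4 * x ^ 2 / (1 - 2 * x) := by
  have h1 := hasSum_of_abs_le_two_pow hc (x := x) (by rwa [abs_of_nonneg h0])
  rw [← hasSum_nat_add_iff' 2] at h1
  simp only [Finset.sum_range_succ, Finset.sum_range_zero, zero_add, pow_zero, mul_one,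
    pow_one] at h1
  have h2 := (hasSum_geometric_of_lt_one (r := 2 * x) (by linarith) (by linarith)).mul_left
    (4 * x ^ 2)
  rw [← h1.tsum_eq, div_eq_mul_inv, ← Real.norm_eq_abs]
  refine tsum_of_norm_bounded h2 fun n => ?_
  rw [Real.norm_eq_abs, abs_mul, abs_of_nonneg (by positivity : 0 ≤ x ^ (n + 2))]
  calc |c (n + 2)| * x ^ (n + 2) ≤ 2 ^ (n + 2) * x ^ (n + 2) := by
        gcongr
        exact hc _
    _ = _ := by rw [mul_pow]; ring

/-! ### The two Frobenius solutions at infinity -/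

/-- Coefficients of the power series `A`, `B` in `x = 1 / τ`: with the exponent `σ / 4`,
`σ = ±1`, they are determined by `A 0 = 1`, `B 0 = 0` and the linear system
`4 (1 + x) A' = σ (3 A - 2√2 B)`, `4 x (1 + x) B' = σ ((2 - x) B + 2√2 x A)`. -/
noncomputable def frobCoeff (σ : ℝ) : ℕ → ℝ × ℝ
  | 0 => (1, 0)
  | n + 1 =>
    (((3 * σ - 4 * n) * (frobCoeff σ n).1 - 2 * √2 * σ * (frobCoeff σ n).2) / (4 * (n + 1)),
      (2 * √2 * σ * (frobCoeff σ n).1 - (4 * n + σ) * (frobCoeff σ n).2) / (4 * (n + 1) - 2 * σ))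

lemma sqrt_two_lt : √2 < 1.415 := by
  rw [Real.sqrt_lt' (by norm_num)]; norm_num

lemma lt_sqrt_two : 1.414 < √2 := by
  rw [Real.lt_sqrt (by norm_num)]; norm_num

lemma sqrt_two_sq : √2 ^ 2 = 2 := Real.sq_sqrt (by norm_num)

lemma abs_frobCoeff_le {σ : ℝ} (hσ : σ = 1 ∨ σ = -1) (n : ℕ) :
    |(frobCoeff σ n).1| ≤ 2 ^ n ∧ |(frobCoeff σ n).2| ≤ 2 ^ n := by
  have hσ1 : |σ| = 1 := by rcases hσ with rfl | rfl <;> norm_num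
  have hσ2 := abs_le.1 hσ1.le
  have hs := sqrt_two_lt
  have hs0 := lt_sqrt_two
  have key : |2 * √2 * σ| ≤ 3 := by
    rw [abs_mul, hσ1, mul_one, abs_of_pos (by positivity)]; linarith
  induction n with
  | zero => simp [frobCoeff]
  | succ n ih =>
    obtain ⟨ha, hb⟩ := ih
    set a := (frobCoeff σ n).1
    set b := (frobCoeff σ n).2
    have hn : (0 : ℝ) ≤ n := n.cast_nonneg
    have hP : (0 : ℝ) ≤ 2 ^ n := by positivity
    have e1 : |3 * σ - 4 * n| ≤ 4 * n + 3 := abs_le.2 ⟨by linarith, by linarith⟩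
    have e2 : |4 * n + σ| ≤ 4 * n + 1 := abs_le.2 ⟨by linarith, by linarith⟩
    constructor
    · change |((3 * σ - 4 * n) * a - 2 * √2 * σ * b) / (4 * ((n : ℝ) + 1))| ≤ _
      rw [abs_div, abs_of_pos (by positivity : (0 : ℝ) < 4 * (n + 1)), div_le_iff₀ (by positivity)]
      calc _ ≤ |3 * σ - 4 * n| * |a| + |2 * √2 * σ| * |b| := by
            rw [← abs_mul, ← abs_mul]; exact abs_sub _ _
        _ ≤ (4 * n + 3) * 2 ^ n + 3 * 2 ^ n := by gcongr
        _ ≤ _ := by rw [pow_succ]; nlinarith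
    · change |(2 * √2 * σ * a - (4 * n + σ) * b) / (4 * ((n : ℝ) + 1) - 2 * σ)| ≤ _
      have hpos : 0 < 4 * ((n : ℝ) + 1) - 2 * σ := by linarith
      rw [abs_div, abs_of_pos hpos, div_le_iff₀ hpos]
      calc _ ≤ |2 * √2 * σ| * |a| + |4 * n + σ| * |b| := by
            rw [← abs_mul, ← abs_mul]; exact abs_sub _ _
        _ ≤ 3 * 2 ^ n + (4 * n + 1) * 2 ^ n := by gcongr
        _ ≤ _ := by rw [pow_succ]; nlinarith

/-- The power series `A` of the Frobenius solution with exponent `σ / 4`. -/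
noncomputable def frobA (σ x : ℝ) : ℝ := ∑' n, (frobCoeff σ n).1 * x ^ n

/-- The power series `B` of the Frobenius solution with exponent `σ / 4`. -/
noncomputable def frobB (σ x : ℝ) : ℝ := ∑' n, (frobCoeff σ n).2 * x ^ n

lemma hasDerivAt_frob {σ : ℝ} (hσ : σ = 1 ∨ σ = -1) {x : ℝ} (hx : |x| < 1 / 2) :
    ∃ A' B' : ℝ, HasDerivAt (frobA σ) A' x ∧ HasDerivAt (frobB σ) B' x ∧
      4 * (1 + x) * A' = σ * (3 * frobA σ x - 2 * √2 * frobB σ x) ∧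
      4 * x * (1 + x) * B' = σ * ((2 - x) * frobB σ x + 2 * √2 * x * frobA σ x) := by
  have hca := fun n => (abs_frobCoeff_le hσ n).1
  have hcb := fun n => (abs_frobCoeff_le hσ n).2
  obtain ⟨A', hA', sA'⟩ := hasDerivAt_tsum_of_abs_le_two_pow hca hx
  obtain ⟨B', hB', sB'⟩ := hasDerivAt_tsum_of_abs_le_two_pow hcb hx
  refine ⟨A', B', hA', hB', ?_, ?_⟩
  · have sA := hasSum_of_abs_le_two_pow hca hx
    have sB := hasSum_of_abs_le_two_pow hcb hx
    -- the series of `x A'`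
    have sxA' : HasSum (fun n : ℕ => (n : ℝ) * (frobCoeff σ n).1 * x ^ n) (x * A') := by
      rw [← hasSum_nat_add_iff' 1]
      simp only [Finset.sum_range_one, Nat.cast_zero, zero_mul, sub_zero]
      refine (sA'.mul_left x).congr_fun fun n => ?_
      push_cast; ring
    have h1 := (sA'.mul_left 4).add (sxA'.mul_left 4)
    have h2 := ((sA.mul_left 3).sub (sB.mul_left (2 * √2))).mul_left σ
    have h3 := h1.unique (h2.congr_fun fun n => ?_)
    · simp only [frobA, frobB]; linarith
    · have hn : (4 * ((n : ℝ) + 1)) ≠ 0 := by positivity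
      have : (frobCoeff σ (n + 1)).1 * (4 * ((n : ℝ) + 1))
          = (3 * σ - 4 * n) * (frobCoeff σ n).1 - 2 * √2 * σ * (frobCoeff σ n).2 := by
        simp only [frobCoeff]; field_simp
      linear_combination x ^ n * this
  · have sA := hasSum_of_abs_le_two_pow hca hx
    have sB := hasSum_of_abs_le_two_pow hcb hx
    have sxB' : HasSum (fun n : ℕ => (n : ℝ) * (frobCoeff σ n).2 * x ^ n) (x * B') := by
      rw [← hasSum_nat_add_iff' 1]
      simp only [Finset.sum_range_one, Nat.cast_zero, zero_mul, sub_zero]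
      refine (sB'.mul_left x).congr_fun fun n => ?_
      push_cast; ring
    -- `B` has no constant term, so its series can be shifted
    have sB1 : HasSum (fun n : ℕ => (frobCoeff σ (n + 1)).2 * x ^ (n + 1)) (frobB σ x) := by
      have := sB
      rw [← hasSum_nat_add_iff' 1] at this
      simpa [frobCoeff, frobB] using this
    have h1 := ((sB'.mul_left (4 * x)).add (sxB'.mul_left (4 * x)))
    have h2 := ((sB1.mul_left 2).sub (sB.mul_left x) |>.add (sA.mul_left (2 * √2 * x))).mul_left σ
    have h3 := h1.unique (h2.congr_fun fun n => ?_)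
    · simp only [frobA, frobB] at h3 ⊢; linear_combination h3
    · have hn : (4 * ((n : ℝ) + 1) - 2 * σ) ≠ 0 := by
        have : (0 : ℝ) ≤ n := n.cast_nonneg
        rcases hσ with rfl | rfl <;> · apply ne_of_gt; linarith
      have : (frobCoeff σ (n + 1)).2 * (4 * ((n : ℝ) + 1) - 2 * σ)
          = 2 * √2 * σ * (frobCoeff σ n).1 - (4 * n + σ) * (frobCoeff σ n).2 := by
        simp only [frobCoeff]; field_simp
      rw [pow_succ]
      linear_combination x ^ n * x * this

lemma abs_frobA_sub_le {σ : ℝ} (hσ : σ = 1 ∨ σ = -1) {x : ℝ} (h0 : 0 ≤ x) (hx : x < 1 / 2) :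
    |frobA σ x - (1 + 3 * σ / 4 * x)| ≤ 4 * x ^ 2 / (1 - 2 * x) := by
  have := abs_tsum_sub_le_of_abs_le_two_pow (fun n => (abs_frobCoeff_le hσ n).1) h0 hx
  simpa [frobA, frobCoeff] using this

lemma abs_frobB_sub_le {σ : ℝ} (hσ : σ = 1 ∨ σ = -1) {x : ℝ} (h0 : 0 ≤ x) (hx : x < 1 / 2) :
    |frobB σ x - 2 * √2 * σ / (4 - 2 * σ) * x| ≤ 4 * x ^ 2 / (1 - 2 * x) := by
  have := abs_tsum_sub_le_of_abs_le_two_pow (fun n => (abs_frobCoeff_le hσ n).2) h0 hx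
  simpa [frobB, frobCoeff] using this

/-- First component of the Frobenius solution of `p' = b q`, `q' = a p` with exponent `σ / 4`.
In the coordinates `(√2 + 1) p ± q`, which diagonalize the leading part of the system at infinity,
the components are multiples of `A` and `B`. -/
noncomputable def frobP (σ τ : ℝ) : ℝ :=
  σ * (√2 - 1) * τ ^ (σ / 4) * (frobA σ τ⁻¹ + frobB σ τ⁻¹)

/-- Second component of the Frobenius solution of `p' = b q`, `q' = a p` with exponent `σ / 4`. -/
noncomputable def frobQ (σ τ : ℝ) : ℝ :=
  τ ^ (σ / 4) * (frobA σ τ⁻¹ - frobB σ τ⁻¹)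

/-- `(p, q)` solves the linear system `p' = b q`, `q' = a p` on `(2, ∞)`; then `p / q` solves the
Riccati equation wherever `q ≠ 0`. -/
structure IsLinSol (p q : ℝ → ℝ) : Prop where
  hasDerivAt_fst : ∀ τ > 2, HasDerivAt p (coeffB τ * q τ) τ
  hasDerivAt_snd : ∀ τ > 2, HasDerivAt q (coeffA τ * p τ) τ

lemma isLinSol_frob {σ : ℝ} (hσ : σ = 1 ∨ σ = -1) : IsLinSol (frobP σ) (frobQ σ) := by
  have h2 := sqrt_two_sq
  have main : ∀ τ > 2, HasDerivAt (frobP σ) (coeffB τ * frobQ σ τ) τ ∧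
      HasDerivAt (frobQ σ) (coeffA τ * frobP σ τ) τ := by
    intro τ hτ
    have hτ0 : 0 < τ := by linarith
    have hx : |τ⁻¹| < 1 / 2 := by
      rw [abs_of_pos (by positivity), one_div]; exact inv_strictAnti₀ (by norm_num) hτ
    obtain ⟨A', B', hA, hB, eA, eB⟩ := hasDerivAt_frob hσ hx
    have hinv := hasDerivAt_inv hτ0.ne'
    have hA1 := hA.comp τ hinv
    have hB1 := hB.comp τ hinv
    have hpw : HasDerivAt (fun t : ℝ => t ^ (σ / 4)) (σ / 4 * τ⁻¹ * τ ^ (σ / 4)) τ := by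
      have := Real.hasDerivAt_rpow_const (p := σ / 4) (Or.inl hτ0.ne')
      rw [Real.rpow_sub_one hτ0.ne'] at this
      convert this using 1
      field_simp
    have hp : HasDerivAt (frobP σ) _ τ := (hpw.const_mul (σ * (√2 - 1))).mul (hA1.add hB1)
    have hq : HasDerivAt (frobQ σ) _ τ := hpw.mul (hA1.sub hB1)
    have eA' : A' = σ * (3 * frobA σ τ⁻¹ - 2 * √2 * frobB σ τ⁻¹) / (4 * (1 + τ⁻¹)) := by
      rw [eq_div_iff (by positivity)]; linarith
    have eB' : B' = σ * ((2 - τ⁻¹) * frobB σ τ⁻¹ + 2 * √2 * τ⁻¹ * frobA σ τ⁻¹)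
        / (4 * τ⁻¹ * (1 + τ⁻¹)) := by
      rw [eq_div_iff (by positivity)]; linarith
    constructor
    · refine hp.congr_deriv ?_
      simp only [frobQ, coeffB, eA', eB']
      clear hA1 hB1 hA hB hp hq eA eB eA' eB' hpw
      generalize frobA σ τ⁻¹ = A
      generalize frobB σ τ⁻¹ = B
      generalize τ ^ (σ / 4) = T
      generalize √2 = t at h2 ⊢
      rcases hσ with rfl | rfl
      · field_simp
        grind
      · field_simp
        grind
    · refine hq.congr_deriv ?_
      simp only [frobP, coeffA, eA', eB']
      clear hA1 hB1 hA hB hp hq eA eB eA' eB' hpw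
      generalize frobA σ τ⁻¹ = A
      generalize frobB σ τ⁻¹ = B
      generalize τ ^ (σ / 4) = T
      generalize √2 = t at h2 ⊢
      rcases hσ with rfl | rfl
      · field_simp
        grind
      · field_simp
        grind
  exact ⟨fun τ h => (main τ h).1, fun τ h => (main τ h).2⟩

/-! ### Behaviour of the Frobenius solutions at infinity -/

lemma frobA_isBigO {σ : ℝ} (hσ : σ = 1 ∨ σ = -1) :
    (fun τ : ℝ => frobA σ τ⁻¹ - (1 + 3 * σ / 4 * τ⁻¹)) =O[atTop] fun τ : ℝ => τ⁻¹ ^ 2 := by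
  refine IsBigO.of_bound 8 ?_
  filter_upwards [eventually_ge_atTop 4] with τ hτ
  have hx : τ⁻¹ ≤ 1 / 4 := by rw [one_div]; exact inv_anti₀ (by norm_num) hτ
  have h0 : 0 ≤ τ⁻¹ := inv_nonneg.2 (by linarith)
  rw [Real.norm_eq_abs, Real.norm_eq_abs, abs_of_nonneg (by positivity : 0 ≤ τ⁻¹ ^ 2)]
  refine (abs_frobA_sub_le hσ h0 (by linarith)).trans ?_
  rw [div_le_iff₀ (by linarith)]
  nlinarith [sq_nonneg τ⁻¹]

lemma frobB_isBigO {σ : ℝ} (hσ : σ = 1 ∨ σ = -1) :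
    (fun τ : ℝ => frobB σ τ⁻¹ - 2 * √2 * σ / (4 - 2 * σ) * τ⁻¹)
      =O[atTop] fun τ : ℝ => τ⁻¹ ^ 2 := by
  refine IsBigO.of_bound 8 ?_
  filter_upwards [eventually_ge_atTop 4] with τ hτ
  have hx : τ⁻¹ ≤ 1 / 4 := by rw [one_div]; exact inv_anti₀ (by norm_num) hτ
  have h0 : 0 ≤ τ⁻¹ := inv_nonneg.2 (by linarith)
  rw [Real.norm_eq_abs, Real.norm_eq_abs, abs_of_nonneg (by positivity : 0 ≤ τ⁻¹ ^ 2)]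
  refine (abs_frobB_sub_le hσ h0 (by linarith)).trans ?_
  rw [div_le_iff₀ (by linarith)]
  nlinarith [sq_nonneg τ⁻¹]

lemma tendsto_frobA {σ : ℝ} (hσ : σ = 1 ∨ σ = -1) :
    Tendsto (fun τ : ℝ => frobA σ τ⁻¹) atTop (𝓝 1) := by
  have hi : Tendsto (fun τ : ℝ => τ⁻¹) atTop (𝓝 0) := tendsto_inv_atTop_zero
  have h1 := (frobA_isBigO hσ).trans_tendsto (by simpa using hi.pow 2)
  simpa using h1.add ((hi.const_mul (3 * σ / 4)).const_add 1)

lemma tendsto_mul_frobB {σ : ℝ} (hσ : σ = 1 ∨ σ = -1) :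
    Tendsto (fun τ : ℝ => τ * frobB σ τ⁻¹) atTop (𝓝 (2 * √2 * σ / (4 - 2 * σ))) := by
  have hi : Tendsto (fun τ : ℝ => τ⁻¹) atTop (𝓝 0) := tendsto_inv_atTop_zero
  have h1 := (isBigO_refl (fun τ : ℝ => τ) atTop).mul (frobB_isBigO hσ)
  have h2 : Tendsto (fun τ : ℝ => τ * τ⁻¹ ^ 2) atTop (𝓝 0) := by
    refine hi.congr' ?_
    filter_upwards [eventually_gt_atTop 0] with τ hτ
    field_simp
  have h3 := (h1.trans_tendsto h2).add_const (2 * √2 * σ / (4 - 2 * σ))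
  rw [zero_add] at h3
  refine h3.congr' ?_
  filter_upwards [eventually_gt_atTop 0] with τ hτ
  field_simp
  ring

lemma tendsto_frobB {σ : ℝ} (hσ : σ = 1 ∨ σ = -1) :
    Tendsto (fun τ : ℝ => frobB σ τ⁻¹) atTop (𝓝 0) := by
  have h := (tendsto_mul_frobB hσ).mul tendsto_inv_atTop_zero
  rw [mul_zero] at h
  refine h.congr' ?_
  filter_upwards [eventually_gt_atTop 0] with τ hτ
  field_simp

lemma eventually_frobQ_pos {σ : ℝ} (hσ : σ = 1 ∨ σ = -1) : ∀ᶠ τ in atTop, 0 < frobQ σ τ := by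
  have h := (tendsto_frobA hσ).sub (tendsto_frobB hσ)
  filter_upwards [h.eventually_const_lt (by norm_num : (0 : ℝ) < 1 - 0), eventually_gt_atTop 0]
    with τ h1 hτ
  exact mul_pos (Real.rpow_pos_of_pos hτ _) h1

lemma rpow_quarter_mul_rpow_neg_quarter {τ : ℝ} (hτ : 0 < τ) :
    τ ^ ((1 : ℝ) / 4) * τ ^ ((-1 : ℝ) / 4) = 1 := by
  rw [← Real.rpow_add hτ]; norm_num

lemma tendsto_wronskian_frob :
    Tendsto (fun τ => frobP 1 τ * frobQ (-1) τ - frobP (-1) τ * frobQ 1 τ) atTop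
      (𝓝 (2 * (√2 - 1))) := by
  have a1 := tendsto_frobA (σ := 1) (Or.inl rfl)
  have b1 := tendsto_frobB (σ := 1) (Or.inl rfl)
  have a2 := tendsto_frobA (σ := -1) (Or.inr rfl)
  have b2 := tendsto_frobB (σ := -1) (Or.inr rfl)
  have h := (((a1.add b1).mul (a2.sub b2)).add ((a2.add b2).mul (a1.sub b1))).const_mul (√2 - 1)
  have e : (√2 - 1) * ((1 + 0) * (1 - 0) + (1 + 0) * (1 - 0)) = 2 * (√2 - 1) := by ring
  rw [e] at h
  refine h.congr' ?_
  filter_upwards [eventually_gt_atTop 0] with τ hτ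
  have := rpow_quarter_mul_rpow_neg_quarter hτ
  simp only [frobP, frobQ]
  linear_combination (-(√2 - 1) * ((frobA 1 τ⁻¹ + frobB 1 τ⁻¹) * (frobA (-1) τ⁻¹ - frobB (-1) τ⁻¹)
    + (frobA (-1) τ⁻¹ + frobB (-1) τ⁻¹) * (frobA 1 τ⁻¹ - frobB 1 τ⁻¹))) * this

/-! ### The linear system -/

lemma coeffA_pos {τ : ℝ} (hτ : 0 < τ) : 0 < coeffA τ := by
  unfold coeffA; positivity

lemma coeffB_pos {τ : ℝ} (hτ : 2 * (√2 + 1) < τ) : 0 < coeffB τ := by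
  have h := lt_sqrt_two
  have : 0 < τ := by linarith
  unfold coeffB
  refine div_pos ?_ (by positivity)
  nlinarith [sqrt_two_sq, mul_pos (by linarith : 0 < √2 - 1) (sub_pos.2 hτ)]

lemma coeffB_neg {τ : ℝ} (h0 : 0 < τ) (hτ : τ < 2 * (√2 + 1)) : coeffB τ < 0 := by
  have h := lt_sqrt_two
  unfold coeffB
  refine div_neg_of_neg_of_pos ?_ (by positivity)
  nlinarith [sqrt_two_sq, mul_pos (by linarith : 0 < √2 - 1) (sub_pos.2 hτ)]

lemma IsLinSol.combine {p q p' q' : ℝ → ℝ} (h : IsLinSol p q) (h' : IsLinSol p' q') (x y : ℝ) :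
    IsLinSol (fun τ => x * p τ + y * p' τ) (fun τ => x * q τ + y * q' τ) where
  hasDerivAt_fst τ hτ :=
    (((h.hasDerivAt_fst τ hτ).const_mul x).add ((h'.hasDerivAt_fst τ hτ).const_mul y)).congr_deriv
      (by ring)
  hasDerivAt_snd τ hτ :=
    (((h.hasDerivAt_snd τ hτ).const_mul x).add ((h'.hasDerivAt_snd τ hτ).const_mul y)).congr_deriv
      (by ring)

lemma eq_of_hasDerivWithinAt_zero {f : ℝ → ℝ} {J : Set ℝ} (hJ : J.OrdConnected)
    (h : ∀ τ ∈ J, HasDerivWithinAt f 0 J τ) {s t : ℝ} (hs : s ∈ J) (ht : t ∈ J) : f s = f t := by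
  have := Convex.norm_image_sub_le_of_norm_hasDerivWithin_le (C := 0) h (fun x _ => by simp)
    hJ.convex ht hs
  rw [zero_mul, norm_le_zero_iff] at this
  linarith

/-- The matrix of the linear system has trace zero, so the Wronskian is constant. -/
lemma IsLinSol.wronskian_eq {p q p' q' : ℝ → ℝ} (h : IsLinSol p q) (h' : IsLinSol p' q')
    {s t : ℝ} (hs : 2 < s) (ht : 2 < t) :
    p s * q' s - p' s * q s = p t * q' t - p' t * q t := by
  refine eq_of_hasDerivWithinAt_zero (f := fun τ => p τ * q' τ - p' τ * q τ)
    (ordConnected_Ioi (a := (2 : ℝ))) (fun τ hτ => ?_) hs ht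
  have := ((h.hasDerivAt_fst τ hτ).mul (h'.hasDerivAt_snd τ hτ)).sub
    ((h'.hasDerivAt_fst τ hτ).mul (h.hasDerivAt_snd τ hτ))
  exact (this.congr_deriv (by ring)).hasDerivWithinAt

lemma wronskian_frob {τ : ℝ} (hτ : 2 < τ) :
    frobP 1 τ * frobQ (-1) τ - frobP (-1) τ * frobQ 1 τ = 2 * (√2 - 1) := by
  refine tendsto_nhds_unique (Tendsto.congr' ?_ tendsto_const_nhds) tendsto_wronskian_frob
  filter_upwards [eventually_gt_atTop 2] with t ht
  exact (isLinSol_frob (Or.inl rfl)).wronskian_eq (isLinSol_frob (Or.inr rfl)) hτ ht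

lemma exists_isLinSol {τ₁ : ℝ} (hτ₁ : 2 < τ₁) (y z : ℝ) :
    ∃ p q : ℝ → ℝ, IsLinSol p q ∧ p τ₁ = y ∧ q τ₁ = z := by
  have hW := wronskian_frob hτ₁
  have h0 : 2 * (√2 - 1) ≠ 0 := by have := lt_sqrt_two; apply ne_of_gt; linarith
  refine ⟨_, _, (isLinSol_frob (σ := 1) (Or.inl rfl)).combine (isLinSol_frob (σ := -1) (Or.inr rfl))
    ((y * frobQ (-1) τ₁ - z * frobP (-1) τ₁) / (2 * (√2 - 1)))
    ((z * frobP 1 τ₁ - y * frobQ 1 τ₁) / (2 * (√2 - 1))), ?_, ?_⟩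
  · rw [div_mul_eq_mul_div, div_mul_eq_mul_div, ← add_div, div_eq_iff h0, ← hW]
    ring
  · rw [div_mul_eq_mul_div, div_mul_eq_mul_div, ← add_div, div_eq_iff h0, ← hW]
    ring

lemma IsLinSol.isSolutionOn_div {p q : ℝ → ℝ} (h : IsLinSol p q) {J : Set ℝ} (hJ : J ⊆ Ioi 2)
    (hq : ∀ τ ∈ J, q τ ≠ 0) : IsSolutionOn (fun τ => p τ / q τ) J := by
  intro τ hτ
  have := (h.hasDerivAt_fst τ (hJ hτ)).div (h.hasDerivAt_snd τ (hJ hτ)) (hq τ hτ)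
  refine (this.congr_deriv ?_).hasDerivWithinAt
  have := hq τ hτ
  field_simp

/-- A solution `u` of the Riccati equation that agrees with `p / q` at one point does so
throughout. The defect `w = p - u q` and the defect `k` of a complementary solution both satisfy
`w' = - a u w`, so that `w² / (w² + k²)` is constant; its denominator never vanishes because the
Wronskian does not. -/
lemma IsLinSol.eq_mul_of_isSolutionOn {p q u : ℝ → ℝ} (h : IsLinSol p q) {J : Set ℝ}
    (hJ : J.OrdConnected) (hJ2 : J ⊆ Ioi 2) (hu : IsSolutionOn u J) {τ₁ : ℝ} (hτ₁ : τ₁ ∈ J)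
    (hpq : p τ₁ = u τ₁ * q τ₁) : ∀ τ ∈ J, p τ = u τ * q τ := by
  by_cases hq1 : q τ₁ = 0 ∧ p τ₁ = 0
  · -- the trivial solution: its Wronskian with every solution vanishes
    intro τ hτ
    obtain ⟨p₁, q₁, h₁, e₁, e₁'⟩ := exists_isLinSol (hJ2 hτ) 1 0
    obtain ⟨p₂, q₂, h₂, e₂, e₂'⟩ := exists_isLinSol (hJ2 hτ) 0 1
    have w₁ := h.wronskian_eq h₁ (hJ2 hτ₁) (hJ2 hτ)
    have w₂ := h.wronskian_eq h₂ (hJ2 hτ₁) (hJ2 hτ)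
    rw [hq1.1, hq1.2, e₁, e₁'] at w₁
    rw [hq1.1, hq1.2, e₂, e₂'] at w₂
    have hp0 : p τ = 0 := by linarith
    have hq0 : q τ = 0 := by linarith
    simp [hp0, hq0]
  obtain ⟨p', q', h', e, e'⟩ := exists_isLinSol (hJ2 hτ₁) (-q τ₁) (p τ₁)
  have hW : ∀ τ ∈ J, p τ * q' τ - p' τ * q τ ≠ 0 := by
    intro τ hτ
    rw [h.wronskian_eq h' (hJ2 hτ) (hJ2 hτ₁), e, e']
    intro h0
    have hsum : p τ₁ ^ 2 + q τ₁ ^ 2 = 0 := by linarith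
    exact hq1 ⟨by nlinarith [sq_nonneg (p τ₁), sq_nonneg (q τ₁)],
      by nlinarith [sq_nonneg (p τ₁), sq_nonneg (q τ₁)]⟩
  have hne : ∀ τ ∈ J, (p τ - u τ * q τ) ^ 2 + (p' τ - u τ * q' τ) ^ 2 ≠ 0 := by
    intro τ hτ h0
    have h1 : p τ - u τ * q τ = 0 := by
      nlinarith [sq_nonneg (p τ - u τ * q τ), sq_nonneg (p' τ - u τ * q' τ)]
    have h2 : p' τ - u τ * q' τ = 0 := by
      nlinarith [sq_nonneg (p τ - u τ * q τ), sq_nonneg (p' τ - u τ * q' τ)]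
    exact hW τ hτ (by linear_combination q' τ * h1 - q τ * h2)
  have hdef : ∀ {P Q : ℝ → ℝ}, IsLinSol P Q → ∀ τ ∈ J,
      HasDerivWithinAt (fun τ => P τ - u τ * Q τ) (-coeffA τ * u τ * (P τ - u τ * Q τ)) J τ := by
    intro P Q H τ hτ
    have := (H.hasDerivAt_fst τ (hJ2 hτ)).hasDerivWithinAt.sub
      ((hu τ hτ).mul (H.hasDerivAt_snd τ (hJ2 hτ)).hasDerivWithinAt)
    exact this.congr_deriv (by ring)
  intro τ hτ
  have hconst := eq_of_hasDerivWithinAt_zero (f := fun τ => (p τ - u τ * q τ) ^ 2 /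
    ((p τ - u τ * q τ) ^ 2 + (p' τ - u τ * q' τ) ^ 2)) hJ (fun t ht => by
      have d1 := (hdef h t ht).pow 2
      have d2 := (hdef h' t ht).pow 2
      refine (d1.div (d1.add d2) (hne t ht)).congr_deriv ?_
      rw [div_eq_zero_iff]
      left
      simp only [Pi.add_apply, Pi.pow_apply]
      push_cast
      ring) hτ hτ₁
  simp only [hpq, sub_self, ne_eq, OfNat.ofNat_ne_zero, not_false_eq_true, zero_pow, zero_div,
    div_eq_zero_iff, pow_eq_zero_iff] at hconst
  rcases hconst with h0 | h0
  · linarith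
  · exact absurd h0 (hne τ hτ)

lemma IsSolutionOn.mono {u : ℝ → ℝ} {J K : Set ℝ} (h : IsSolutionOn u J) (hK : K ⊆ J) :
    IsSolutionOn u K := fun τ hτ => (h τ (hK hτ)).mono hK

lemma IsSolutionOn.continuousOn {u : ℝ → ℝ} {J : Set ℝ} (h : IsSolutionOn u J) :
    ContinuousOn u J := fun τ hτ => (h τ hτ).continuousWithinAt

lemma IsLinSol.continuousOn_snd {p q : ℝ → ℝ} (h : IsLinSol p q) : ContinuousOn q (Ioi 2) :=
  fun τ hτ => (h.hasDerivAt_snd τ hτ).continuousAt.continuousWithinAt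

/-! ### Monotone quantities -/

/-- For a solution of the linear system this is `4 (τ + 1) q² u'`, where `u = p / q`. -/
noncomputable def growth (p q : ℝ → ℝ) (τ : ℝ) : ℝ :=
  (√2 - 1 - 2 / τ) * q τ ^ 2 - (√2 + 1 + 2 / τ) * p τ ^ 2

lemma coeff_eq_growth {p q : ℝ → ℝ} {τ : ℝ} (hτ : 0 < τ) :
    coeffB τ * q τ ^ 2 - coeffA τ * p τ ^ 2 = growth p q τ / (4 * (τ + 1)) := by
  unfold coeffB coeffA growth
  field_simp

/-- The cross terms in the derivative of `growth` cancel, and what remains is positive definite. -/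
lemma IsLinSol.hasDerivAt_growth {p q : ℝ → ℝ} (h : IsLinSol p q) {τ : ℝ} (hτ : 2 < τ) :
    HasDerivAt (growth p q) (2 / τ ^ 2 * (p τ ^ 2 + q τ ^ 2)) τ := by
  have hτ0 : τ ≠ 0 := by linarith
  have hτ1 : τ + 1 ≠ 0 := by linarith
  have d := (hasDerivAt_inv hτ0).const_mul 2
  have dq := (h.hasDerivAt_snd τ hτ).pow 2
  have dp := (h.hasDerivAt_fst τ hτ).pow 2
  have := ((d.const_sub (√2 - 1)).mul dq).sub ((d.const_add (√2 + 1)).mul dp)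
  refine (this.congr_of_eventuallyEq ?_).congr_deriv ?_
  · refine Eventually.of_forall fun t => ?_
    simp [growth, div_eq_mul_inv]
  · simp only [coeffA, coeffB, Pi.pow_apply]
    field_simp
    push_cast
    ring

lemma IsLinSol.strictMonoOn_growth {p q : ℝ → ℝ} (h : IsLinSol p q)
    (hpq : ∀ τ > 2, 0 < p τ ^ 2 + q τ ^ 2) : StrictMonoOn (growth p q) (Ioi 2) := by
  refine strictMonoOn_of_hasDerivWithinAt_pos (convex_Ioi 2)
    (f' := fun τ => 2 / τ ^ 2 * (p τ ^ 2 + q τ ^ 2))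
    (fun τ hτ => (h.hasDerivAt_growth hτ).continuousAt.continuousWithinAt) ?_ ?_
  · intro τ hτ
    rw [interior_Ioi] at hτ
    exact (h.hasDerivAt_growth hτ).hasDerivWithinAt
  · intro τ hτ
    rw [interior_Ioi] at hτ
    have h1 := hpq τ hτ
    have : (0 : ℝ) < τ := by linarith [mem_Ioi.1 hτ]
    positivity

/-- A nontrivial solution of the linear system never vanishes. -/
lemma IsLinSol.sq_add_sq_pos {p q p' q' : ℝ → ℝ} (h : IsLinSol p q) (h' : IsLinSol p' q') {s τ : ℝ}
    (hs : 2 < s) (hτ : 2 < τ) (hW : p s * q' s - p' s * q s ≠ 0) : 0 < p τ ^ 2 + q τ ^ 2 := by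
  rw [h.wronskian_eq h' hs hτ] at hW
  by_contra h0
  have hp : p τ = 0 := by nlinarith [sq_nonneg (p τ), sq_nonneg (q τ)]
  have hq : q τ = 0 := by nlinarith [sq_nonneg (p τ), sq_nonneg (q τ)]
  simp [hp, hq] at hW

lemma lt_of_strictMonoOn_of_tendsto {f : ℝ → ℝ} {c l : ℝ} (hf : StrictMonoOn f (Ioi c))
    (hl : Tendsto f atTop (𝓝 l)) {τ : ℝ} (hτ : c < τ) : f τ < l := by
  have h1 : f τ < f (τ + 1) := hf hτ (hτ.trans (lt_add_one τ)) (lt_add_one τ)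
  refine h1.trans_le (ge_of_tendsto hl ?_)
  filter_upwards [eventually_gt_atTop (τ + 1)] with t ht
  exact (hf (hτ.trans (lt_add_one τ)) ((hτ.trans (lt_add_one τ)).trans ht) ht).le

lemma lt_of_strictAntiOn_of_tendsto {f : ℝ → ℝ} {c l : ℝ} (hf : StrictAntiOn f (Ioi c))
    (hl : Tendsto f atTop (𝓝 l)) {τ : ℝ} (hτ : c < τ) : l < f τ := by
  have := lt_of_strictMonoOn_of_tendsto hf.neg hl.neg hτ
  simpa using this

lemma pos_of_ne_zero_of_eventually_pos {f : ℝ → ℝ} {c : ℝ} (hf : ContinuousOn f (Ici c))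
    (h0 : ∀ τ ≥ c, f τ ≠ 0) (hpos : ∀ᶠ τ in atTop, 0 < f τ) {τ : ℝ} (hτ : c ≤ τ) : 0 < f τ := by
  obtain ⟨t, ht, htτ⟩ := (hpos.and (eventually_ge_atTop τ)).exists
  by_contra h
  obtain ⟨s, hs, hs0⟩ := intermediate_value_Icc htτ
    (hf.mono fun x hx => hτ.trans hx.1) (⟨not_lt.1 h, ht.le⟩ : (0 : ℝ) ∈ Icc (f τ) (f t))
  exact h0 s (hτ.trans hs.1) hs0

lemma frob_sq_add_sq_pos {σ : ℝ} (hσ : σ = 1 ∨ σ = -1) {τ : ℝ} (hτ : 2 < τ) :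
    0 < frobP σ τ ^ 2 + frobQ σ τ ^ 2 := by
  have hW := wronskian_frob hτ
  have h0 := lt_sqrt_two
  rcases hσ with rfl | rfl
  · refine (isLinSol_frob (Or.inl rfl)).sq_add_sq_pos (isLinSol_frob (Or.inr rfl)) hτ hτ ?_
    rw [hW]; apply ne_of_gt; linarith
  · refine (isLinSol_frob (Or.inr rfl)).sq_add_sq_pos (isLinSol_frob (Or.inl rfl)) hτ hτ ?_
    rw [← neg_sub, hW]; apply ne_of_lt; linarith

lemma tendsto_growth_frob {σ : ℝ} (hσ : σ = 1 ∨ σ = -1) :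
    Tendsto (growth (frobP σ) (frobQ σ)) atTop (𝓝 0) := by
  have hσ2 : σ ^ 2 = 1 := by rcases hσ with rfl | rfl <;> norm_num
  have a := tendsto_frobA hσ
  have b := tendsto_frobB hσ
  have tb := tendsto_mul_frobB hσ
  have hpw : Tendsto (fun τ : ℝ => τ ^ (-(1 - σ / 2))) atTop (𝓝 0) :=
    tendsto_rpow_neg_atTop (by rcases hσ with rfl | rfl <;> norm_num)
  have h := hpw.mul (((a.mul tb).const_mul (-(4 * (√2 - 1)))).sub
    ((((a.sub b).pow 2).add (((a.add b).pow 2).const_mul ((√2 - 1) ^ 2))).const_mul 2))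
  rw [zero_mul] at h
  refine h.congr' ?_
  filter_upwards [eventually_gt_atTop 0] with τ hτ
  -- the leading terms of the two squares cancel, so one factor `τ` can be absorbed into `B`
  have e : (τ ^ (σ / 4)) ^ 2 = τ * τ ^ (-(1 - σ / 2)) := by
    rw [← Real.rpow_natCast, ← Real.rpow_mul hτ.le]
    nth_rewrite 2 [← Real.rpow_one τ]
    rw [← Real.rpow_add hτ]
    congr 1
    push_cast
    ring
  have hs := sqrt_two_sq
  simp only [growth, frobP, frobQ, mul_pow, e, hσ2]
  generalize τ ^ (-(1 - σ / 2)) = T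
  generalize frobA σ τ⁻¹ = A
  generalize frobB σ τ⁻¹ = B
  field_simp
  linear_combination (T * (√2 - 1) * (A + B) ^ 2 * τ) * hs

/-- Both Frobenius solutions have negative `growth`: it increases to zero. -/
lemma growth_frob_neg {σ : ℝ} (hσ : σ = 1 ∨ σ = -1) {τ : ℝ} (hτ : 2 < τ) :
    growth (frobP σ) (frobQ σ) τ < 0 :=
  lt_of_strictMonoOn_of_tendsto ((isLinSol_frob hσ).strictMonoOn_growth
    fun _ h => frob_sq_add_sq_pos hσ h) (tendsto_growth_frob hσ) hτ

lemma two_lt_of_lt {τ : ℝ} (hτ : 2 * (√2 + 1) < τ) : 2 < τ := by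
  have := lt_sqrt_two; linarith

/-- The product `p q` of the recessive solution increases to zero, because `a` and `b`
are positive here. In particular `q` has no zeros. -/
lemma frobP_mul_frobQ_neg {τ : ℝ} (hτ : 2 * (√2 + 1) < τ) :
    frobP (-1) τ * frobQ (-1) τ < 0 := by
  have hL := isLinSol_frob (σ := -1) (Or.inr rfl)
  have hder : ∀ t > 2, HasDerivAt (fun t => frobP (-1) t * frobQ (-1) t)
      (coeffB t * frobQ (-1) t ^ 2 + coeffA t * frobP (-1) t ^ 2) t := fun t ht =>
    ((hL.hasDerivAt_fst t ht).mul (hL.hasDerivAt_snd t ht)).congr_deriv (by ring)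
  have hmono : StrictMonoOn (fun t => frobP (-1) t * frobQ (-1) t) (Ioi (2 * (√2 + 1))) := by
    refine strictMonoOn_of_hasDerivWithinAt_pos (convex_Ioi _)
      (f' := fun t => coeffB t * frobQ (-1) t ^ 2 + coeffA t * frobP (-1) t ^ 2)
      (fun t ht => (hder t (two_lt_of_lt ht)).continuousAt.continuousWithinAt) ?_ ?_
    · intro t ht
      rw [interior_Ioi] at ht
      exact (hder t (two_lt_of_lt ht)).hasDerivWithinAt
    · intro t ht
      rw [interior_Ioi] at ht
      have h2 := two_lt_of_lt ht
      have ha := coeffA_pos (by linarith : 0 < t)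
      have hb := coeffB_pos ht
      have h := frob_sq_add_sq_pos (σ := -1) (Or.inr rfl) h2
      rcases (sq_nonneg (frobP (-1) t)).lt_or_eq with hp | hp
      · have := mul_pos ha hp
        have := mul_nonneg hb.le (sq_nonneg (frobQ (-1) t))
        linarith
      · rw [← hp] at h ⊢
        rw [zero_add] at h
        have := mul_pos hb h
        linarith
  have hlim : Tendsto (fun t => frobP (-1) t * frobQ (-1) t) atTop (𝓝 0) := by
    have a := tendsto_frobA (σ := -1) (Or.inr rfl)
    have b := tendsto_frobB (σ := -1) (Or.inr rfl)
    have hpw : Tendsto (fun τ : ℝ => τ ^ (-(1 / 4 : ℝ))) atTop (𝓝 0) :=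
      tendsto_rpow_neg_atTop (by norm_num)
    have h := (hpw.mul hpw).mul (((a.add b).mul (a.sub b)).const_mul (-(√2 - 1)))
    rw [zero_mul, zero_mul] at h
    refine h.congr fun t => ?_
    simp only [frobP, frobQ]
    rw [show (-1 : ℝ) / 4 = -(1 / 4) by norm_num]
    ring
  exact lt_of_strictMonoOn_of_tendsto hmono hlim hτ

lemma frobQ_neg_one_pos {τ : ℝ} (hτ : 2 * (√2 + 1) < τ) : 0 < frobQ (-1) τ := by
  refine pos_of_ne_zero_of_eventually_pos (c := τ)
    ((isLinSol_frob (Or.inr rfl)).continuousOn_snd.mono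
      fun t ht => (two_lt_of_lt hτ).trans_le ht) (fun t ht h0 => ?_)
    (eventually_frobQ_pos (Or.inr rfl)) le_rfl
  have := frobP_mul_frobQ_neg (hτ.trans_le ht)
  simp [h0] at this

/-- The linear terms of the series dominate: here `1 / τ < 0.2075`, and the remainders are at
most `0.3`. -/
lemma frobQ_one_pos {τ : ℝ} (hτ : 2 * (√2 + 1) < τ) : 0 < frobQ 1 τ := by
  have h1 := lt_sqrt_two
  have h2 := sqrt_two_lt
  have hτ0 : 0 < τ := by linarith
  have h0 : 0 < τ⁻¹ := inv_pos.2 hτ0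
  have hx : τ⁻¹ < 0.2075 := by
    rw [inv_lt_comm₀ hτ0 (by norm_num)]
    norm_num
    linarith
  have hA := (abs_le.1 (abs_frobA_sub_le (σ := 1) (Or.inl rfl) h0.le (by linarith))).1
  have hB := (abs_le.1 (abs_frobB_sub_le (σ := 1) (Or.inl rfl) h0.le (by linarith))).2
  have hE : 4 * τ⁻¹ ^ 2 / (1 - 2 * τ⁻¹) ≤ 0.3 := by
    rw [div_le_iff₀ (by linarith)]
    nlinarith
  refine mul_pos (Real.rpow_pos_of_pos hτ0 _) ?_
  norm_num at hA hB hE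
  nlinarith

/-! ### The solutions `ψ₁*` (`σ = 1`) and `ψ₂` (`σ = -1`) -/

/-- The solution of the Riccati equation given by the Frobenius solution with exponent `σ / 4`:
`ψ₁*` for `σ = 1`, and `ψ₂` for `σ = -1`. -/
noncomputable def psi (σ τ : ℝ) : ℝ := frobP σ τ / frobQ σ τ

lemma frobQ_pos {σ : ℝ} (hσ : σ = 1 ∨ σ = -1) {τ : ℝ} (hτ : 2 * (√2 + 1) < τ) :
    0 < frobQ σ τ := by
  rcases hσ with rfl | rfl
  exacts [frobQ_one_pos hτ, frobQ_neg_one_pos hτ]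

lemma isSolutionOn_psi {σ : ℝ} (hσ : σ = 1 ∨ σ = -1) :
    IsSolutionOn (psi σ) (Ioi (2 * (√2 + 1))) :=
  (isLinSol_frob hσ).isSolutionOn_div (fun _ hτ => two_lt_of_lt hτ)
    fun _ hτ => (frobQ_pos hσ hτ).ne'

/-- Sign of the right-hand side of the Riccati equation in terms of `growth`. -/
lemma rhs_eq_growth {p q u : ℝ → ℝ} {τ : ℝ} (hτ : 0 < τ) (hq : q τ ≠ 0) (hu : p τ = u τ * q τ) :
    coeffB τ - coeffA τ * u τ ^ 2 = growth p q τ / (4 * (τ + 1) * q τ ^ 2) := by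
  have := coeff_eq_growth (p := p) (q := q) hτ
  rw [← div_div, ← this, hu]
  field_simp

lemma IsSolutionOn.strictAntiOn {u : ℝ → ℝ} {J : Set ℝ} (hJ : J.OrdConnected)
    (hu : IsSolutionOn u J) (h : ∀ τ ∈ J, coeffB τ - coeffA τ * u τ ^ 2 < 0) :
    StrictAntiOn u J :=
  strictAntiOn_of_hasDerivWithinAt_neg hJ.convex hu.continuousOn
    (fun τ hτ => (hu τ (interior_subset hτ)).mono interior_subset)
    fun τ hτ => h τ (interior_subset hτ)

lemma IsSolutionOn.strictMonoOn {u : ℝ → ℝ} {J : Set ℝ} (hJ : J.OrdConnected)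
    (hu : IsSolutionOn u J) (h : ∀ τ ∈ J, 0 < coeffB τ - coeffA τ * u τ ^ 2) :
    StrictMonoOn u J :=
  strictMonoOn_of_hasDerivWithinAt_pos hJ.convex hu.continuousOn
    (fun τ hτ => (hu τ (interior_subset hτ)).mono interior_subset)
    fun τ hτ => h τ (interior_subset hτ)

lemma rhs_psi_neg {σ : ℝ} (hσ : σ = 1 ∨ σ = -1) {τ : ℝ} (hτ : 2 * (√2 + 1) < τ) :
    coeffB τ - coeffA τ * psi σ τ ^ 2 < 0 := by
  have h2 := two_lt_of_lt hτ
  have hq := frobQ_pos hσ hτ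
  rw [rhs_eq_growth (p := frobP σ) (q := frobQ σ) (by linarith) hq.ne'
    (by rw [psi, div_mul_cancel₀ _ hq.ne'])]
  exact div_neg_of_neg_of_pos (growth_frob_neg hσ h2) (by positivity)

lemma strictAntiOn_psi {σ : ℝ} (hσ : σ = 1 ∨ σ = -1) :
    StrictAntiOn (psi σ) (Ioi (2 * (√2 + 1))) :=
  (isSolutionOn_psi hσ).strictAntiOn ordConnected_Ioi fun _ => rhs_psi_neg hσ

lemma psi_eq {σ τ : ℝ} (hτ : 0 < τ) :
    psi σ τ = σ * (√2 - 1) * (frobA σ τ⁻¹ + frobB σ τ⁻¹) / (frobA σ τ⁻¹ - frobB σ τ⁻¹) := by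
  have hT := (Real.rpow_pos_of_pos hτ (σ / 4)).ne'
  rw [← mul_div_mul_left _ _ hT, psi, frobP, frobQ]
  congr 1
  ring

lemma tendsto_psi {σ : ℝ} (hσ : σ = 1 ∨ σ = -1) :
    Tendsto (psi σ) atTop (𝓝 (σ * (√2 - 1))) := by
  have a := tendsto_frobA hσ
  have b := tendsto_frobB hσ
  have h := ((a.add b).const_mul (σ * (√2 - 1))).div (a.sub b) (by norm_num)
  simp only [add_zero, sub_zero, mul_one, div_one] at h
  refine h.congr' ?_
  filter_upwards [eventually_gt_atTop 0] with τ hτ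
  rw [psi_eq hτ, Pi.div_apply]

lemma lt_psi {σ : ℝ} (hσ : σ = 1 ∨ σ = -1) {τ : ℝ} (hτ : 2 * (√2 + 1) < τ) :
    σ * (√2 - 1) < psi σ τ :=
  lt_of_strictAntiOn_of_tendsto (strictAntiOn_psi hσ) (tendsto_psi hσ) hτ

lemma psi_neg_one_neg {τ : ℝ} (hτ : 2 * (√2 + 1) < τ) : psi (-1) τ < 0 := by
  have hq := frobQ_neg_one_pos hτ
  have h := frobP_mul_frobQ_neg hτ
  exact div_neg_of_neg_of_pos (by nlinarith) hq

/-- First-order expansion of `ψ₁*` and `ψ₂` in `1 / τ`. -/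
lemma psi_isBigO {σ : ℝ} (hσ : σ = 1 ∨ σ = -1) :
    (fun τ : ℝ => psi σ τ - (σ * (√2 - 1) + σ * (√2 - 1) * (4 * √2 * σ / (4 - 2 * σ)) * τ⁻¹))
      =O[atTop] fun τ : ℝ => τ⁻¹ ^ 2 := by
  set b₁ : ℝ := 2 * √2 * σ / (4 - 2 * σ) with hb₁
  have hx := isBigO_refl (fun τ : ℝ => τ⁻¹) atTop
  have hle : (fun τ : ℝ => τ⁻¹ ^ 2) =O[atTop] fun τ : ℝ => τ⁻¹ := by
    have h := ((tendsto_inv_atTop_zero (𝕜 := ℝ)).isBigO_one ℝ).mul hx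
    simpa [sq] using h
  have a := frobA_isBigO hσ
  have b := frobB_isBigO hσ
  have a0 : (fun τ : ℝ => frobA σ τ⁻¹ - 1) =O[atTop] fun τ : ℝ => τ⁻¹ := by
    refine ((a.trans hle).add (hx.const_mul_left (3 * σ / 4))).congr_left fun τ => ?_
    ring
  have b0 : (fun τ : ℝ => frobB σ τ⁻¹) =O[atTop] fun τ : ℝ => τ⁻¹ := by
    refine ((b.trans hle).add (hx.const_mul_left b₁)).congr_left fun τ => ?_
    ring
  have hinv : (fun τ : ℝ => (frobA σ τ⁻¹ - frobB σ τ⁻¹)⁻¹) =O[atTop] fun _ => (1 : ℝ) :=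
    (((tendsto_frobA hσ).sub (tendsto_frobB hσ)).inv₀ (by norm_num)).isBigO_one ℝ
  have xa : (fun τ : ℝ => τ⁻¹ * (frobA σ τ⁻¹ - 1)) =O[atTop] fun τ : ℝ => τ⁻¹ ^ 2 := by
    simpa only [sq] using hx.mul a0
  have xb : (fun τ : ℝ => τ⁻¹ * frobB σ τ⁻¹) =O[atTop] fun τ : ℝ => τ⁻¹ ^ 2 := by
    simpa only [sq] using hx.mul b0
  have h := (((b.const_mul_left 2).sub (xa.const_mul_left (2 * b₁))).add
    (xb.const_mul_left (2 * b₁))).const_mul_left (σ * (√2 - 1)) |>.mul hinv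
  refine h.congr' ?_ (Eventually.of_forall fun τ => by simp)
  filter_upwards [eventually_gt_atTop 0, eventually_frobQ_pos hσ] with τ hτ hq
  have hT := (Real.rpow_pos_of_pos hτ (σ / 4))
  have hd : frobA σ τ⁻¹ - frobB σ τ⁻¹ ≠ 0 := (pos_of_mul_pos_right hq hT.le).ne'
  have e2 : 4 * √2 * σ / (4 - 2 * σ) = 2 * b₁ := by rw [hb₁]; ring
  rw [psi_eq hτ, e2, ← hb₁]
  clear_value b₁
  generalize frobA σ τ⁻¹ = A at *
  generalize frobB σ τ⁻¹ = B at *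
  field_simp
  ring

/-! ### Expansions at infinity -/

lemma tendsto_four_mul_sq : Tendsto (fun r : ℝ => 4 * r ^ 2) atTop atTop :=
  (tendsto_pow_atTop two_ne_zero).const_mul_atTop (by norm_num)

/-- An expansion determines the parameter `C` as a limit. -/
lemma HasExpansion.tendsto_mul {u : ℝ → ℝ} {C : ℝ} (h : HasExpansion u C) :
    Tendsto (fun r : ℝ => r * (u (4 * r ^ 2) - (√2 - 1))) atTop (𝓝 C) := by
  have hi : Tendsto (fun r : ℝ => r⁻¹) atTop (𝓝 0) := tendsto_inv_atTop_zero
  have h1 := (isBigO_refl (fun r : ℝ => r) atTop).mul h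
  have h2 : Tendsto (fun r : ℝ => r * (1 / r ^ 3)) atTop (𝓝 0) := by
    have := hi.pow 2
    rw [zero_pow two_ne_zero] at this
    refine this.congr' ?_
    filter_upwards [eventually_gt_atTop 0] with r hr
    field_simp
  have h3 := (h1.trans_tendsto h2).add ((hi.const_mul (coeffD C)).const_add C)
  rw [mul_zero, add_zero, zero_add] at h3
  refine h3.congr' ?_
  filter_upwards [eventually_gt_atTop 0] with r hr
  field_simp
  ring

lemma HasExpansion.unique {u : ℝ → ℝ} {C C' : ℝ} (h : HasExpansion u C)
    (h' : HasExpansion u C') : C = C' :=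
  tendsto_nhds_unique h.tendsto_mul h'.tendsto_mul

lemma eventually_of_comp_four_mul_sq {P : ℝ → Prop} (h : ∀ᶠ r : ℝ in atTop, P (4 * r ^ 2)) :
    ∀ᶠ τ in atTop, P τ := by
  have h2 : Tendsto (fun τ : ℝ => √τ / 2) atTop atTop :=
    Real.tendsto_sqrt_atTop.atTop_div_const (by norm_num)
  filter_upwards [h2.eventually h, eventually_ge_atTop 0] with τ h3 hτ
  rwa [div_pow, Real.sq_sqrt hτ, show 4 * (τ / 2 ^ 2) = τ by ring] at h3

lemma HasExpansion.tendsto {u : ℝ → ℝ} {C : ℝ} (h : HasExpansion u C) :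
    Tendsto u atTop (𝓝 (√2 - 1)) := by
  suffices h2 : Tendsto (fun r : ℝ => u (4 * r ^ 2)) atTop (𝓝 (√2 - 1)) from
    fun s hs => eventually_of_comp_four_mul_sq (h2 hs)
  have h1 := (h.tendsto_mul.mul tendsto_inv_atTop_zero).add_const (√2 - 1)
  rw [mul_zero, zero_add] at h1
  refine h1.congr' ?_
  filter_upwards [eventually_gt_atTop 0] with r hr
  field_simp
  ring

lemma HasExpansion.congr {u v : ℝ → ℝ} {C : ℝ} (h : HasExpansion u C) (huv : u =ᶠ[atTop] v) :
    HasExpansion v C := by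
  refine IsBigO.congr' h ?_ EventuallyEq.rfl
  filter_upwards [tendsto_four_mul_sq.eventually huv] with r hr
  rw [hr]

/-- First component of the solution of the linear system whose quotient has expansion
parameter `C`. The coefficient `-(√2 + 1) C` of the recessive solution is read off from the `1 / r`
term of the quotient. -/
noncomputable def famP (C τ : ℝ) : ℝ := 1 * frobP 1 τ + (-(√2 + 1) * C) * frobP (-1) τ

/-- Second component of the solution of the linear system whose quotient has expansion
parameter `C`. -/
noncomputable def famQ (C τ : ℝ) : ℝ := 1 * frobQ 1 τ + (-(√2 + 1) * C) * frobQ (-1) τ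

lemma isLinSol_fam (C : ℝ) : IsLinSol (famP C) (famQ C) :=
  (isLinSol_frob (Or.inl rfl)).combine (isLinSol_frob (Or.inr rfl)) 1 (-(√2 + 1) * C)

/-- `famP` and `famQ` at `τ = 4 r²`, with their leading power of `τ` split off. -/
lemma fam_four_mul_sq (C : ℝ) {r : ℝ} (hr : 0 < r) :
    famP C (4 * r ^ 2) = (4 * r ^ 2) ^ ((1 : ℝ) / 4) * ((√2 - 1) *
      (frobA 1 (4 * r ^ 2)⁻¹ + frobB 1 (4 * r ^ 2)⁻¹) + C / 2 * r⁻¹ *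
        (frobA (-1) (4 * r ^ 2)⁻¹ + frobB (-1) (4 * r ^ 2)⁻¹)) ∧
    famQ C (4 * r ^ 2) = (4 * r ^ 2) ^ ((1 : ℝ) / 4) *
      (frobA 1 (4 * r ^ 2)⁻¹ - frobB 1 (4 * r ^ 2)⁻¹ - (√2 + 1) * C / 2 * r⁻¹ *
        (frobA (-1) (4 * r ^ 2)⁻¹ - frobB (-1) (4 * r ^ 2)⁻¹)) := by
  have e : (4 * r ^ 2 : ℝ) ^ ((-1 : ℝ) / 4) = (4 * r ^ 2) ^ ((1 : ℝ) / 4) * (r⁻¹ / 2) := by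
    have h4 : (4 * r ^ 2 : ℝ) ^ (-(1 / 2) : ℝ) = r⁻¹ / 2 := by
      rw [Real.rpow_neg (by positivity), ← Real.sqrt_eq_rpow,
        show (4 * r ^ 2 : ℝ) = (2 * r) ^ 2 by ring, Real.sqrt_sq (by positivity)]
      field_simp
    rw [← h4, ← Real.rpow_add (by positivity)]
    norm_num
  simp only [famP, famQ, frobP, frobQ, e]
  constructor
  · linear_combination ((4 * r ^ 2) ^ ((1 : ℝ) / 4) * C / 2 * r⁻¹ *
      (frobA (-1) (4 * r ^ 2)⁻¹ + frobB (-1) (4 * r ^ 2)⁻¹)) * sqrt_two_sq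
  · ring

lemma tendsto_famQ_reduced (C : ℝ) :
    Tendsto (fun r : ℝ => frobA 1 (4 * r ^ 2)⁻¹ - frobB 1 (4 * r ^ 2)⁻¹ -
      (√2 + 1) * C / 2 * r⁻¹ * (frobA (-1) (4 * r ^ 2)⁻¹ - frobB (-1) (4 * r ^ 2)⁻¹))
      atTop (𝓝 1) := by
  have h4 := tendsto_four_mul_sq
  have a1 := (tendsto_frobA (σ := 1) (Or.inl rfl)).comp h4
  have b1 := (tendsto_frobB (σ := 1) (Or.inl rfl)).comp h4
  have a2 := (tendsto_frobA (σ := -1) (Or.inr rfl)).comp h4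
  have b2 := (tendsto_frobB (σ := -1) (Or.inr rfl)).comp h4
  have hi : Tendsto (fun r : ℝ => r⁻¹) atTop (𝓝 0) := tendsto_inv_atTop_zero
  have := (a1.sub b1).sub ((hi.const_mul ((√2 + 1) * C / 2)).mul (a2.sub b2))
  simpa using this

lemma eventually_half_lt_famQ (C : ℝ) : ∀ᶠ τ in atTop, 1 / 2 < famQ C τ := by
  refine eventually_of_comp_four_mul_sq ?_
  filter_upwards [(tendsto_famQ_reduced C).eventually_const_lt (by norm_num : (1 : ℝ) / 2 < 1),
    eventually_ge_atTop 1] with r h1 hr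
  rw [(fam_four_mul_sq C (by linarith)).2]
  have h2 : (1 : ℝ) ≤ (4 * r ^ 2) ^ ((1 : ℝ) / 4) :=
    Real.one_le_rpow (by nlinarith) (by norm_num)
  nlinarith

lemma isBigO_inv_pow_of_le {m n : ℕ} (h : n ≤ m) :
    (fun r : ℝ => r⁻¹ ^ m) =O[atTop] fun r : ℝ => r⁻¹ ^ n := by
  refine IsBigO.of_bound 1 ?_
  filter_upwards [eventually_ge_atTop 1] with r hr
  have h0 : 0 ≤ r⁻¹ := inv_nonneg.2 (by linarith)
  rw [Real.norm_of_nonneg (by positivity), Real.norm_of_nonneg (by positivity), one_mul]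
  exact pow_le_pow_of_le_one h0 (inv_le_one_of_one_le₀ hr) h

lemma hasExpansion_fam (C : ℝ) : HasExpansion (fun τ => famP C τ / famQ C τ) C := by
  have hs := sqrt_two_sq
  have h4 := tendsto_four_mul_sq
  have hsq : (fun r : ℝ => (4 * r ^ 2)⁻¹ ^ 2) =O[atTop] fun r : ℝ => r⁻¹ ^ 3 := by
    refine ((isBigO_inv_pow_of_le (show 3 ≤ 4 by norm_num)).const_mul_left (1 / 16)).congr_left
      fun r => ?_
    rw [mul_inv, inv_pow]
    ring
  have h2le := isBigO_inv_pow_of_le (show 2 ≤ 3 by norm_num)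
  have eA : (fun r : ℝ => frobA 1 (4 * r ^ 2)⁻¹ - (1 + 3 / 16 * r⁻¹ ^ 2)) =O[atTop]
      fun r : ℝ => r⁻¹ ^ 3 := by
    refine (((frobA_isBigO (σ := 1) (Or.inl rfl)).comp_tendsto h4).trans hsq).congr_left
      fun r => ?_
    simp only [Function.comp_apply]
    rw [mul_inv, inv_pow]
    ring
  have eB : (fun r : ℝ => frobB 1 (4 * r ^ 2)⁻¹ - √2 / 4 * r⁻¹ ^ 2) =O[atTop]
      fun r : ℝ => r⁻¹ ^ 3 := by
    refine (((frobB_isBigO (σ := 1) (Or.inl rfl)).comp_tendsto h4).trans hsq).congr_left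
      fun r => ?_
    simp only [Function.comp_apply]
    rw [mul_inv, inv_pow]
    ring
  -- the recessive series carry a factor `1 / r`
  have fA : (fun r : ℝ => r⁻¹ * (frobA (-1) (4 * r ^ 2)⁻¹ - 1)) =O[atTop]
      fun r : ℝ => r⁻¹ ^ 3 := by
    have := (((frobA_isBigO (σ := -1) (Or.inr rfl)).comp_tendsto h4).trans hsq).trans h2le |>.add
      ((isBigO_refl (fun r : ℝ => r⁻¹ ^ 2) atTop).const_mul_left (-3 / 16))
    refine ((isBigO_refl (fun r : ℝ => r⁻¹) atTop).mul this).congr (fun r => ?_) fun r => by ring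
    simp only [Function.comp_apply]
    rw [mul_inv, inv_pow]
    ring
  have fB : (fun r : ℝ => r⁻¹ * frobB (-1) (4 * r ^ 2)⁻¹) =O[atTop] fun r : ℝ => r⁻¹ ^ 3 := by
    have := (((frobB_isBigO (σ := -1) (Or.inr rfl)).comp_tendsto h4).trans hsq).trans h2le |>.add
      ((isBigO_refl (fun r : ℝ => r⁻¹ ^ 2) atTop).const_mul_left (-√2 / 12))
    refine ((isBigO_refl (fun r : ℝ => r⁻¹) atTop).mul this).congr (fun r => ?_) fun r => by ring
    simp only [Function.comp_apply]
    rw [mul_inv, inv_pow]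
    ring
  have hi : Tendsto (fun r : ℝ => r⁻¹) atTop (𝓝 0) := tendsto_inv_atTop_zero
  -- With `N`, `M` for `famP`, `famQ` without their leading power, the quotient minus its expansion
  -- has numerator `N - (√2 - 1 + C / r + D / r²) M`, whose terms of order less than three in `1 / r`
  -- cancel by the choice of `D`.
  have hpoly : (fun r : ℝ => √2 - 1 + C * r⁻¹ + coeffD C * r⁻¹ ^ 2) =O[atTop]
      fun _ => (1 : ℝ) :=
    (((hi.const_mul C).const_add (√2 - 1)).add ((hi.pow 2).const_mul (coeffD C))).isBigO_one ℝ
  have hM := hpoly.mul ((eA.sub eB).sub ((fA.sub fB).const_mul_left ((√2 + 1) * C / 2)))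
  have h3 := (isBigO_refl (fun r : ℝ => r⁻¹ ^ 3) atTop).const_mul_left
    (C * (3 / 16 - √2 / 4) - coeffD C * ((√2 + 1) * C / 2))
  have h4' := (isBigO_inv_pow_of_le (show 3 ≤ 4 by norm_num)).const_mul_left
    (coeffD C * (3 / 16 - √2 / 4))
  have hN := ((eA.add eB).const_mul_left (√2 - 1)).add ((fA.add fB).const_mul_left (C / 2))
  have hnum := ((hN.sub (hM.congr_right fun r => one_mul _)).sub h3).sub h4'
  have hinv := ((tendsto_famQ_reduced C).inv₀ one_ne_zero).isBigO_one ℝ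
  refine (hnum.mul hinv).congr' ?_ (Eventually.of_forall fun r => by simp)
  filter_upwards [eventually_gt_atTop 0, (tendsto_famQ_reduced C).eventually_const_lt
    (by norm_num : (0 : ℝ) < 1)] with r hr hpos
  obtain ⟨e1, e2⟩ := fam_four_mul_sq C hr
  have hT : (0 : ℝ) < (4 * r ^ 2) ^ ((1 : ℝ) / 4) := by positivity
  refine mul_right_cancel₀ hpos.ne' ?_
  rw [e1, e2, mul_div_mul_left _ _ hT.ne', mul_assoc, inv_mul_cancel₀ hpos.ne', mul_one]
  refine Eq.trans ?_ (sub_mul _ _ _).symm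
  rw [div_mul_cancel₀ _ hpos.ne', div_eq_mul_inv C r, div_eq_mul_inv (coeffD C), ← inv_pow, coeffD]
  generalize frobA 1 (4 * r ^ 2)⁻¹ = A1
  generalize frobB 1 (4 * r ^ 2)⁻¹ = B1
  generalize frobA (-1) (4 * r ^ 2)⁻¹ = A2
  generalize frobB (-1) (4 * r ^ 2)⁻¹ = B2
  generalize r⁻¹ = ρ
  linear_combination (-(C / 2 * ρ)) * hs

/-! ### Uniqueness, comparison and classification -/

lemma IsLinSol.sq_add_sq_pos_of_snd_ne_zero {p q : ℝ → ℝ} (h : IsLinSol p q) {s τ : ℝ}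
    (hs : 2 < s) (hτ : 2 < τ) (hq : q s ≠ 0) : 0 < p τ ^ 2 + q τ ^ 2 := by
  obtain ⟨p', q', h', e, e'⟩ := exists_isLinSol hs 1 0
  refine h.sq_add_sq_pos h' hs hτ ?_
  rw [e, e']
  simpa using hq

lemma IsLinSol.snd_ne_zero {p q u : ℝ → ℝ} (h : IsLinSol p q) {s τ : ℝ}
    (hs : 2 < s) (hτ : 2 < τ) (hq : q s ≠ 0) (hu : p τ = u τ * q τ) : q τ ≠ 0 := by
  intro h0
  have := h.sq_add_sq_pos_of_snd_ne_zero hs hτ hq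
  simp [hu, h0] at this

lemma IsSolutionOn.eqOn {u v : ℝ → ℝ} {J : Set ℝ} (hJ : J.OrdConnected) (hJ2 : J ⊆ Ioi 2)
    (hu : IsSolutionOn u J) (hv : IsSolutionOn v J) {t : ℝ} (ht : t ∈ J) (h : u t = v t) :
    EqOn u v J := by
  obtain ⟨p, q, hpq, hp, hq⟩ := exists_isLinSol (hJ2 ht) (u t) 1
  intro τ hτ
  have h1 := hpq.eq_mul_of_isSolutionOn hJ hJ2 hu ht (by rw [hp, hq, mul_one]) τ hτ
  have h2 := hpq.eq_mul_of_isSolutionOn hJ hJ2 hv ht (by rw [hp, hq, mul_one, h]) τ hτ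
  exact mul_right_cancel₀ (hpq.snd_ne_zero (hJ2 ht) (hJ2 hτ) (by rw [hq]; exact one_ne_zero) h1)
    (h1.symm.trans h2)

lemma IsSolutionOn.lt_of_lt {u v : ℝ → ℝ} {J : Set ℝ} (hJ : J.OrdConnected) (hJ2 : J ⊆ Ioi 2)
    (hu : IsSolutionOn u J) (hv : IsSolutionOn v J) {s t : ℝ} (hs : s ∈ J) (ht : t ∈ J)
    (h : u s < v s) : u t < v t := by
  by_contra hlt
  obtain ⟨x, hx, hxe⟩ := hJ.isPreconnected.intermediate_value₂ hs ht hu.continuousOn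
    hv.continuousOn h.le (not_lt.1 hlt)
  exact h.ne (IsSolutionOn.eqOn hJ hJ2 hu hv hx hxe hs)

/-- Every solution near infinity is the quotient of the recessive solution or of a member of the
family `famP C`, `famQ C`. -/
lemma IsSolutionOn.recessive_or_fam {u : ℝ → ℝ} {τ₁ : ℝ} (hτ₁ : 2 < τ₁)
    (hu : IsSolutionOn u (Ici τ₁)) :
    (∀ τ ≥ τ₁, frobP (-1) τ = u τ * frobQ (-1) τ) ∨
      ∃ C, ∀ τ ≥ τ₁, famP C τ = u τ * famQ C τ := by
  have hJ2 : Ici τ₁ ⊆ Ioi 2 := fun τ hτ => hτ₁.trans_le hτ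
  by_cases h : frobP (-1) τ₁ = u τ₁ * frobQ (-1) τ₁
  · exact Or.inl ((isLinSol_frob (Or.inr rfl)).eq_mul_of_isSolutionOn ordConnected_Ici hJ2 hu
      self_mem_Ici h)
  · right
    have h' := sub_ne_zero.2 h
    refine ⟨(√2 - 1) * ((frobP 1 τ₁ - u τ₁ * frobQ 1 τ₁) /
      (frobP (-1) τ₁ - u τ₁ * frobQ (-1) τ₁)), ?_⟩
    refine (isLinSol_fam _).eq_mul_of_isSolutionOn ordConnected_Ici hJ2 hu self_mem_Ici ?_
    have e : -(√2 + 1) * ((√2 - 1) * ((frobP 1 τ₁ - u τ₁ * frobQ 1 τ₁) /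
      (frobP (-1) τ₁ - u τ₁ * frobQ (-1) τ₁))) = -((frobP 1 τ₁ - u τ₁ * frobQ 1 τ₁) /
      (frobP (-1) τ₁ - u τ₁ * frobQ (-1) τ₁)) := by
      linear_combination (-((frobP 1 τ₁ - u τ₁ * frobQ 1 τ₁) /
        (frobP (-1) τ₁ - u τ₁ * frobQ (-1) τ₁))) * sqrt_two_sq
    rw [famP, famQ, e]
    field_simp
    ring

lemma hasExpansion_of_fam {u : ℝ → ℝ} {τ₁ C : ℝ} (h : ∀ τ ≥ τ₁, famP C τ = u τ * famQ C τ) :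
    HasExpansion u C := by
  refine (hasExpansion_fam C).congr ?_
  filter_upwards [eventually_half_lt_famQ C, eventually_ge_atTop τ₁] with τ h1 h2
  rw [h τ h2, mul_div_cancel_right₀]
  linarith

lemma tendsto_of_recessive {u : ℝ → ℝ} {τ₁ : ℝ}
    (h : ∀ τ ≥ τ₁, frobP (-1) τ = u τ * frobQ (-1) τ) : Tendsto u atTop (𝓝 (-(√2 - 1))) := by
  have h1 := tendsto_psi (σ := -1) (Or.inr rfl)
  rw [neg_one_mul] at h1
  refine h1.congr' ?_
  filter_upwards [eventually_frobQ_pos (σ := -1) (Or.inr rfl), eventually_ge_atTop τ₁] with τ h1 h2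
  rw [psi, h τ h2, mul_div_cancel_right₀ _ h1.ne']

lemma neg_limit_lt_limit : -(√2 - 1) < √2 - 1 := by
  have := lt_sqrt_two; linarith

lemma IsSolutionOn.fam_of_hasExpansion {u : ℝ → ℝ} {τ₁ C : ℝ} (hτ₁ : 2 < τ₁)
    (hu : IsSolutionOn u (Ici τ₁)) (hC : HasExpansion u C) :
    ∀ τ ≥ τ₁, famP C τ = u τ * famQ C τ := by
  rcases hu.recessive_or_fam hτ₁ with h | ⟨C', h⟩
  · exact absurd (tendsto_nhds_unique (tendsto_of_recessive h) hC.tendsto) neg_limit_lt_limit.ne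
  · rwa [hC.unique (hasExpansion_of_fam h)]

lemma IsSolutionOn.exists_hasExpansion {u : ℝ → ℝ} {τ₁ : ℝ}
    (hu : IsSolutionOn u (Ici τ₁)) (h : Tendsto u atTop (𝓝 (√2 - 1))) :
    ∃ C, HasExpansion u C := by
  have hu' := hu.mono (Ici_subset_Ici.2 (le_max_left τ₁ 3))
  rcases hu'.recessive_or_fam (lt_max_of_lt_right (by norm_num)) with h1 | ⟨C, h1⟩
  · exact absurd (tendsto_nhds_unique (tendsto_of_recessive h1) h) neg_limit_lt_limit.ne
  · exact ⟨C, hasExpansion_of_fam h1⟩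

lemma hasExpansion_unique_solution {u v : ℝ → ℝ} {τ₁ C : ℝ} (hτ₁ : 2 < τ₁)
    (hu : IsSolutionOn u (Ici τ₁)) (hv : IsSolutionOn v (Ici τ₁)) (hC : HasExpansion u C)
    (hC' : HasExpansion v C) : EqOn u v (Ici τ₁) := by
  obtain ⟨t, ht, ht'⟩ := ((eventually_half_lt_famQ C).and (eventually_ge_atTop τ₁)).exists
  refine IsSolutionOn.eqOn ordConnected_Ici (fun τ hτ => hτ₁.trans_le hτ) hu hv (t := t) ht' ?_
  have h1 := hu.fam_of_hasExpansion hτ₁ hC t ht'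
  have h2 := hv.fam_of_hasExpansion hτ₁ hC' t ht'
  exact mul_right_cancel₀ (by linarith) (h1.symm.trans h2)

lemma exists_solution_hasExpansion (C : ℝ) :
    ∃ (τ₁ : ℝ) (u : ℝ → ℝ), 2 < τ₁ ∧ IsSolutionOn u (Ici τ₁) ∧ HasExpansion u C := by
  obtain ⟨t, ht⟩ := eventually_atTop.1 (eventually_half_lt_famQ C)
  refine ⟨max t 3, _, lt_max_of_lt_right (by norm_num), (isLinSol_fam C).isSolutionOn_div ?_ ?_,
    hasExpansion_fam C⟩
  · intro τ hτ
    have : (3 : ℝ) ≤ τ := (le_max_right _ _).trans hτ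
    exact mem_Ioi.2 (by linarith)
  · intro τ hτ
    have := ht τ ((le_max_left _ _).trans hτ)
    linarith

lemma tan_pi_div_eight : Real.tan (Real.pi / 8) = √2 - 1 := by
  have hpi := Real.pi_pos
  have h0 : 0 < Real.tan (Real.pi / 8) := Real.tan_pos_of_pos_of_lt_pi_div_two (by positivity)
    (by linarith)
  have h1 := Real.tan_two_mul (x := Real.pi / 8)
  rw [show 2 * (Real.pi / 8) = Real.pi / 4 by ring, Real.tan_pi_div_four] at h1
  set t := Real.tan (Real.pi / 8)
  have hne : 1 - t ^ 2 ≠ 0 := by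
    intro h
    rw [h, div_zero] at h1
    exact one_ne_zero h1
  rw [eq_div_iff hne] at h1
  have h2 : √2 = t + 1 := by
    rw [show (2 : ℝ) = (t + 1) ^ 2 by linarith, Real.sqrt_sq (by linarith)]
  linarith

/-! ### Solutions on either side of `ψ₂` -/

lemma isSolutionOn_psi_Ici {σ τ₁ : ℝ} (hσ : σ = 1 ∨ σ = -1) (hτ₁ : 2 * (√2 + 1) < τ₁) :
    IsSolutionOn (psi σ) (Ici τ₁) :=
  (isSolutionOn_psi hσ).mono fun _ hτ => hτ₁.trans_le hτ

lemma Ici_subset_Ioi_two {τ₁ : ℝ} (hτ₁ : 2 * (√2 + 1) < τ₁) : Ici τ₁ ⊆ Ioi 2 :=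
  fun _ hτ => (two_lt_of_lt hτ₁).trans_le hτ

/-- A global solution equals `ψ₂` or has an expansion with limit `tan (π / 8)`. -/
lemma IsSolutionOn.eqOn_psi_or_hasExpansion {u : ℝ → ℝ} {τ₁ : ℝ} (hτ₁ : 2 * (√2 + 1) < τ₁)
    (hu : IsSolutionOn u (Ici τ₁)) : EqOn u (psi (-1)) (Ici τ₁) ∨ ∃ C, HasExpansion u C := by
  rcases hu.recessive_or_fam (two_lt_of_lt hτ₁) with h | ⟨C, h⟩
  · left
    intro τ hτ
    rw [psi, h τ hτ, mul_div_cancel_right₀ _ (frobQ_neg_one_pos (hτ₁.trans_le hτ)).ne']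
  · exact Or.inr ⟨C, hasExpansion_of_fam h⟩

/-- No solution below `ψ₂` is global: it would have to tend to `tan (π / 8)`. -/
lemma IsSolutionOn.psi_le {u : ℝ → ℝ} {τ₁ : ℝ} (hτ₁ : 2 * (√2 + 1) < τ₁)
    (hu : IsSolutionOn u (Ici τ₁)) : psi (-1) τ₁ ≤ u τ₁ := by
  by_contra! hlt
  rcases hu.eqOn_psi_or_hasExpansion hτ₁ with h | ⟨C, h⟩
  · exact hlt.ne (h self_mem_Ici)
  · have h1 : ∀ τ ≥ τ₁, u τ < psi (-1) τ := fun τ hτ =>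
      IsSolutionOn.lt_of_lt ordConnected_Ici (Ici_subset_Ioi_two hτ₁) hu
        (isSolutionOn_psi_Ici (Or.inr rfl) hτ₁) self_mem_Ici hτ hlt
    have h2 := le_of_tendsto_of_tendsto h.tendsto (tendsto_psi (σ := -1) (Or.inr rfl))
      ((eventually_ge_atTop τ₁).mono fun τ hτ => (h1 τ hτ).le)
    have := neg_limit_lt_limit
    linarith

/-- The quotient of `q` by the second component of the recessive solution is increasing as long as
`p / q` lies above `ψ₂`. -/
lemma IsLinSol.div_frobQ_le {p q : ℝ → ℝ} (h : IsLinSol p q) {τ₁ : ℝ} (hτ₁ : 2 * (√2 + 1) < τ₁)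
    (hlt : psi (-1) τ₁ * q τ₁ < p τ₁) {τ : ℝ} (hτ : τ₁ ≤ τ) :
    q τ₁ / frobQ (-1) τ₁ ≤ q τ / frobQ (-1) τ := by
  have hL := isLinSol_frob (σ := -1) (Or.inr rfl)
  have hW : ∀ t ≥ τ₁, 0 < p t * frobQ (-1) t - frobP (-1) t * q t := by
    intro t ht
    rw [h.wronskian_eq hL ((two_lt_of_lt hτ₁).trans_le ht) (two_lt_of_lt hτ₁)]
    have hq := frobQ_neg_one_pos hτ₁
    rw [psi, div_mul_eq_mul_div, div_lt_iff₀ hq] at hlt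
    linarith
  have hder : ∀ t ≥ τ₁, HasDerivAt (fun t => q t / frobQ (-1) t)
      (coeffA t * (p t * frobQ (-1) t - frobP (-1) t * q t) / frobQ (-1) t ^ 2) t := by
    intro t ht
    have h2 := (two_lt_of_lt hτ₁).trans_le ht
    exact ((h.hasDerivAt_snd t h2).div (hL.hasDerivAt_snd t h2)
      (frobQ_neg_one_pos (hτ₁.trans_le ht)).ne').congr_deriv (by ring)
  refine (strictMonoOn_of_hasDerivWithinAt_pos (convex_Ici τ₁)
    (f' := fun t => coeffA t * (p t * frobQ (-1) t - frobP (-1) t * q t) / frobQ (-1) t ^ 2)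
    (fun t ht => (hder t ht).continuousAt.continuousWithinAt)
    (fun t ht => (hder t (interior_subset ht)).hasDerivWithinAt) fun t ht => ?_).monotoneOn
    self_mem_Ici hτ hτ
  have ht' : τ₁ ≤ t := interior_subset ht
  have h2 := (two_lt_of_lt hτ₁).trans_le ht'
  have := frobQ_neg_one_pos (hτ₁.trans_le ht')
  exact div_pos (mul_pos (coeffA_pos (by linarith)) (hW t ht')) (by positivity)

lemma IsLinSol.snd_pos {p q : ℝ → ℝ} (h : IsLinSol p q) {τ₁ : ℝ} (hτ₁ : 2 * (√2 + 1) < τ₁)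
    (hq : 0 < q τ₁) (hlt : psi (-1) τ₁ * q τ₁ < p τ₁) {τ : ℝ} (hτ : τ₁ ≤ τ) : 0 < q τ := by
  have h1 := (div_pos hq (frobQ_neg_one_pos hτ₁)).trans_le (h.div_frobQ_le hτ₁ hlt hτ)
  exact (div_pos_iff_of_pos_right (frobQ_neg_one_pos (hτ₁.trans_le hτ))).1 h1

lemma exists_isSolutionOn_of_psi_lt {τ₁ y : ℝ} (hτ₁ : 2 * (√2 + 1) < τ₁) (hy : psi (-1) τ₁ < y) :
    ∃ u : ℝ → ℝ, IsSolutionOn u (Ici τ₁) ∧ u τ₁ = y ∧ ∃ C, HasExpansion u C := by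
  obtain ⟨p, q, h, hp, hq⟩ := exists_isLinSol (two_lt_of_lt hτ₁) y 1
  have hu : IsSolutionOn (fun τ => p τ / q τ) (Ici τ₁) :=
    h.isSolutionOn_div (Ici_subset_Ioi_two hτ₁) fun τ hτ =>
      (h.snd_pos hτ₁ (by rw [hq]; exact one_pos) (by rwa [hp, hq, mul_one]) hτ).ne'
  have e : p τ₁ / q τ₁ = y := by rw [hp, hq, div_one]
  refine ⟨_, hu, e, (hu.eqOn_psi_or_hasExpansion hτ₁).resolve_left fun h1 => ?_⟩
  exact hy.ne' (e.symm.trans (h1 self_mem_Ici))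

/-! ### Maximal solutions -/

lemma forwardInterval_top (τ₁ : ℝ) : forwardInterval τ₁ ⊤ = Ici τ₁ := by
  ext τ; simp [forwardInterval]

lemma forwardInterval_coe (τ₁ t : ℝ) : forwardInterval τ₁ (t : WithTop ℝ) = Ico τ₁ t := by
  ext τ; simp [forwardInterval]

lemma ordConnected_forwardInterval (τ₁ : ℝ) (T : WithTop ℝ) :
    (forwardInterval τ₁ T).OrdConnected :=
  ⟨fun _ hx _ hy _ hz =>
    ⟨hx.1.trans hz.1, (WithTop.coe_le_coe.2 hz.2).trans_lt hy.2⟩⟩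

lemma forwardInterval_subset_Ioi {τ₁ : ℝ} (hτ₁ : 2 < τ₁) (T : WithTop ℝ) :
    forwardInterval τ₁ T ⊆ Ioi 2 := fun _ hτ => hτ₁.trans_le hτ.1

/-- The first zero of `q` after `τ₁`. -/
lemma IsLinSol.exists_first_zero {p q : ℝ → ℝ} (h : IsLinSol p q) {τ₁ : ℝ} (hτ₁ : 2 < τ₁)
    (hq : 0 < q τ₁) (h0 : ∃ s ≥ τ₁, q s = 0) :
    ∃ t > τ₁, q t = 0 ∧ ∀ s ∈ Ico τ₁ t, 0 < q s := by
  have hc : ContinuousOn q (Ici τ₁) := h.continuousOn_snd.mono fun s hs => hτ₁.trans_le hs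
  have hcl : IsClosed (Ici τ₁ ∩ q ⁻¹' {0}) :=
    hc.preimage_isClosed_of_isClosed isClosed_Ici isClosed_singleton
  obtain ⟨s, hs, hs0⟩ := h0
  have hl := hcl.isLeast_csInf ⟨s, hs, hs0⟩ ⟨τ₁, fun x hx => hx.1⟩
  set t := sInf (Ici τ₁ ∩ q ⁻¹' {0})
  refine ⟨t, lt_of_le_of_ne hl.1.1 fun e => ?_, hl.1.2, fun x hx => ?_⟩
  · rw [e] at hq
    exact hq.ne' hl.1.2
  · by_contra hneg
    obtain ⟨y, hy, hy0⟩ := intermediate_value_Icc' hx.1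
      (hc.mono fun z hz => hz.1) (⟨not_lt.1 hneg, hq.le⟩ : (0 : ℝ) ∈ Icc (q x) (q τ₁))
    exact absurd (hl.2 ⟨hy.1, hy0⟩) (not_le.2 (hy.2.trans_lt hx.2))

/-- The maximal solution `p / q` ends exactly at the first zero of `q`: there `p ≠ 0`. -/
lemma IsLinSol.isMaximalSolution_div {p q : ℝ → ℝ} (h : IsLinSol p q) {τ₁ t : ℝ} (hτ₁ : 2 < τ₁)
    (ht : τ₁ < t) (hqt : q t = 0) (hpos : ∀ s ∈ Ico τ₁ t, 0 < q s) :
    IsMaximalSolution (fun τ => p τ / q τ) τ₁ t where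
  lt := WithTop.coe_lt_coe.2 ht
  isSolutionOn := by
    rw [forwardInterval_coe]
    exact h.isSolutionOn_div (fun s hs => hτ₁.trans_le hs.1) fun s hs => (hpos s hs).ne'
  maximal := by
    intro T' v hT' hv heq
    have hq1 := (hpos τ₁ ⟨le_rfl, ht⟩).ne'
    have h1 : τ₁ ∈ forwardInterval τ₁ T' := ⟨le_rfl, (WithTop.coe_lt_coe.2 ht).trans hT'⟩
    have h2 := h.eq_mul_of_isSolutionOn (ordConnected_forwardInterval τ₁ T')
      (forwardInterval_subset_Ioi hτ₁ T') hv h1 (by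
        rw [heq ⟨le_rfl, WithTop.coe_lt_coe.2 ht⟩, div_mul_cancel₀ _ hq1]) t ⟨ht.le, hT'⟩
    exact h.snd_ne_zero hτ₁ (hτ₁.trans ht) hq1 h2 hqt

lemma exists_isMaximalSolution {τ₁ : ℝ} (hτ₁ : 2 < τ₁) (y : ℝ) :
    ∃ (T : WithTop ℝ) (u : ℝ → ℝ), IsMaximalSolution u τ₁ T ∧ u τ₁ = y := by
  obtain ⟨p, q, h, hp, hq⟩ := exists_isLinSol hτ₁ y 1
  by_cases h0 : ∃ s ≥ τ₁, q s = 0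
  · obtain ⟨t, ht, hqt, hpos⟩ := h.exists_first_zero hτ₁ (by rw [hq]; exact one_pos) h0
    exact ⟨t, _, h.isMaximalSolution_div hτ₁ ht hqt hpos, by simp [hp, hq]⟩
  · push Not at h0
    refine ⟨⊤, fun τ => p τ / q τ, ⟨WithTop.coe_lt_top _, ?_, fun T' _ hT' => ?_⟩, by
      simp [hp, hq]⟩
    · rw [forwardInterval_top]
      exact h.isSolutionOn_div (fun s hs => hτ₁.trans_le hs) h0
    · exact absurd hT' not_top_lt

lemma IsMaximalSolution.not_lt_of_isSolutionOn {u v : ℝ → ℝ} {τ₁ : ℝ} {T T' : WithTop ℝ}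
    (hτ₁ : 2 < τ₁) (hu : IsMaximalSolution u τ₁ T) (hv : IsSolutionOn v (forwardInterval τ₁ T'))
    (h : v τ₁ = u τ₁) : ¬ T < T' := by
  intro hT
  refine hu.maximal T' v hT hv ?_
  exact IsSolutionOn.eqOn (ordConnected_forwardInterval τ₁ T) (forwardInterval_subset_Ioi hτ₁ T)
    (hv.mono fun τ hτ => ⟨hτ.1, hτ.2.trans hT⟩) hu.isSolutionOn ⟨le_rfl, hu.lt⟩ h

lemma IsMaximalSolution.eq_of_eq {u v : ℝ → ℝ} {τ₁ : ℝ} {T T' : WithTop ℝ} (hτ₁ : 2 < τ₁)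
    (hu : IsMaximalSolution u τ₁ T) (hv : IsMaximalSolution v τ₁ T') (h : v τ₁ = u τ₁) : T = T' :=
  le_antisymm (not_lt.1 (hv.not_lt_of_isSolutionOn hτ₁ hu.isSolutionOn h.symm))
    (not_lt.1 (hu.not_lt_of_isSolutionOn hτ₁ hv.isSolutionOn h))

lemma IsMaximalSolution.of_psi_lt {u : ℝ → ℝ} {τ₁ : ℝ} {T : WithTop ℝ}
    (hτ₁ : 2 * (√2 + 1) < τ₁) (hu : IsMaximalSolution u τ₁ T) (hlt : psi (-1) τ₁ < u τ₁) :
    T = ⊤ ∧ (∀ τ ≥ τ₁, psi (-1) τ < u τ) ∧ Tendsto u atTop (𝓝 (√2 - 1)) := by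
  obtain ⟨v, hv, hv1, -⟩ := exists_isSolutionOn_of_psi_lt hτ₁ hlt
  have hT : T = ⊤ := not_lt_top_iff.1
    (hu.not_lt_of_isSolutionOn (two_lt_of_lt hτ₁) (by rwa [forwardInterval_top]) hv1)
  have hu' := hu.isSolutionOn
  rw [hT, forwardInterval_top] at hu'
  refine ⟨hT, fun τ hτ => IsSolutionOn.lt_of_lt ordConnected_Ici (Ici_subset_Ioi_two hτ₁)
    (isSolutionOn_psi_Ici (Or.inr rfl) hτ₁) hu' self_mem_Ici hτ hlt, ?_⟩
  rcases hu'.eqOn_psi_or_hasExpansion hτ₁ with h | ⟨C, h⟩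
  · exact absurd (h self_mem_Ici) hlt.ne'
  · exact h.tendsto

lemma IsMaximalSolution.of_lt_psi {u : ℝ → ℝ} {τ₁ : ℝ} {T : WithTop ℝ}
    (hτ₁ : 2 * (√2 + 1) < τ₁) (hu : IsMaximalSolution u τ₁ T) (hlt : u τ₁ < psi (-1) τ₁) :
    ∃ t : ℝ, T = (t : WithTop ℝ) ∧ StrictAntiOn u (Ico τ₁ t) ∧
      StrictMonoOn (fun τ => psi (-1) τ - u τ) (Ico τ₁ t) ∧ Tendsto u (𝓝[<] t) atBot := by
  have h2 := two_lt_of_lt hτ₁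
  obtain ⟨p, q, h, hp, hq⟩ := exists_isLinSol h2 (u τ₁) 1
  have hzero : ∃ s ≥ τ₁, q s = 0 := by
    by_contra! h0
    have := (h.isSolutionOn_div (Ici_subset_Ioi_two hτ₁) h0).psi_le hτ₁
    simp only [hp, hq, div_one] at this
    linarith
  obtain ⟨t, ht, hqt, hpos⟩ := h.exists_first_zero h2 (by rw [hq]; exact one_pos) hzero
  have hT : T = (t : WithTop ℝ) := hu.eq_of_eq h2 (h.isMaximalSolution_div h2 ht hqt hpos)
    (by simp [hp, hq])
  have hsol := hu.isSolutionOn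
  rw [hT, forwardInterval_coe] at hsol
  have hJ2 : Ico τ₁ t ⊆ Ioi 2 := fun s hs => h2.trans_le hs.1
  have hpsi : IsSolutionOn (psi (-1)) (Ico τ₁ t) :=
    (isSolutionOn_psi_Ici (Or.inr rfl) hτ₁).mono fun s hs => hs.1
  have hτ₁m : τ₁ ∈ Ico τ₁ t := ⟨le_rfl, ht⟩
  have hlt' : ∀ τ ∈ Ico τ₁ t, u τ < psi (-1) τ := fun τ hτ =>
    IsSolutionOn.lt_of_lt ordConnected_Ico hJ2 hsol hpsi hτ₁m hτ hlt
  -- `u < ψ₂ < 0`, hence `u² > ψ₂²`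
  have hsq : ∀ τ ∈ Ico τ₁ t, 0 < coeffA τ * (u τ ^ 2 - psi (-1) τ ^ 2) := by
    intro τ hτ
    have h3 := hlt' τ hτ
    have h4 := psi_neg_one_neg (hτ₁.trans_le hτ.1)
    exact mul_pos (coeffA_pos (by linarith [mem_Ioi.1 (hJ2 hτ)])) (by nlinarith)
  refine ⟨t, hT, hsol.strictAntiOn ordConnected_Ico fun τ hτ => ?_, ?_, ?_⟩
  · have h3 := rhs_psi_neg (σ := -1) (Or.inr rfl) (hτ₁.trans_le hτ.1)
    have := hsq τ hτ
    linarith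
  · refine strictMonoOn_of_hasDerivWithinAt_pos (convex_Ico τ₁ t)
      (f' := fun τ => coeffA τ * (u τ ^ 2 - psi (-1) τ ^ 2))
      (hpsi.continuousOn.sub hsol.continuousOn) (fun τ hτ => ?_)
      fun τ hτ => hsq τ (interior_subset hτ)
    have hτ' := interior_subset hτ
    exact (((hpsi τ hτ').sub (hsol τ hτ')).mono interior_subset).congr_deriv (by ring)
  · have heq := h.eq_mul_of_isSolutionOn ordConnected_Ico hJ2 hsol hτ₁m (by rw [hp, hq, mul_one])
    have h2t := h2.trans ht
    have hIco : Ico τ₁ t ∈ 𝓝[<] t := Ico_mem_nhdsLT ht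
    have hpc : Tendsto p (𝓝[<] t) (𝓝 (p t)) :=
      (h.hasDerivAt_fst t h2t).continuousAt.tendsto.mono_left nhdsWithin_le_nhds
    have hqc : Tendsto q (𝓝[<] t) (𝓝[>] 0) := by
      refine tendsto_nhdsWithin_iff.2 ⟨?_, ?_⟩
      · have := (h.hasDerivAt_snd t h2t).continuousAt.tendsto.mono_left
          (nhdsWithin_le_nhds (s := Iio t))
        rwa [hqt] at this
      · filter_upwards [hIco] with s hs using hpos s hs
    have hpt : p t < 0 := by
      refine lt_of_le_of_ne (le_of_tendsto hpc ?_) fun h0 => ?_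
      · filter_upwards [hIco] with s hs
        rw [heq s hs]
        have h3 := hlt' s hs
        have h4 := psi_neg_one_neg (hτ₁.trans_le hs.1)
        exact mul_nonpos_of_nonpos_of_nonneg (by linarith) (hpos s hs).le
      · have := h.sq_add_sq_pos_of_snd_ne_zero h2 h2t (by rw [hq]; exact one_ne_zero)
        simp [h0, hqt] at this
    refine (hpc.neg_mul_atTop hpt (tendsto_inv_nhdsGT_zero.comp hqc)).congr' ?_
    filter_upwards [hIco] with s hs
    rw [heq s hs, Function.comp_apply, mul_assoc, mul_inv_cancel₀ (hpos s hs).ne', mul_one]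

/-! ### Stability -/

/-- Solutions above `ψ₂` are stable. With `u = P / Q` and the recessive pair `(p, q)`, the
perturbed solution is `(P + s p) / (Q + s q)`; its distance to `u` is
`|s| |W| / (Q (Q + s q))`, where the Wronskian `W` is constant, `Q` is bounded below and `q` is at
most a multiple of `Q`. -/
lemma IsSolutionOn.isLyapunovStable {u : ℝ → ℝ} {τ₀ : ℝ} (hτ₀ : 2 * (√2 + 1) < τ₀)
    (hu : IsSolutionOn u (Ici τ₀)) (hlt : psi (-1) τ₀ < u τ₀) : IsLyapunovStable u τ₀ := by
  have h2 := two_lt_of_lt hτ₀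
  obtain ⟨C, hC⟩ := (hu.eqOn_psi_or_hasExpansion hτ₀).resolve_left
    fun h => hlt.ne' (h self_mem_Ici)
  have hL := isLinSol_frob (σ := -1) (Or.inr rfl)
  have hF := isLinSol_fam C
  have heq := hu.fam_of_hasExpansion h2 hC
  have hcont : ContinuousOn (famQ C) (Ici τ₀) :=
    hF.continuousOn_snd.mono (Ici_subset_Ioi_two hτ₀)
  obtain ⟨t, ht⟩ := eventually_atTop.1 (eventually_half_lt_famQ C)
  have ht' := ht (max t 3) (le_max_left _ _)
  have h3 : (2 : ℝ) < max t 3 := lt_max_of_lt_right (by norm_num)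
  have hQpos : ∀ τ ≥ τ₀, 0 < famQ C τ := fun τ hτ =>
    pos_of_ne_zero_of_eventually_pos hcont
      (fun s hs => hF.snd_ne_zero h3 (h2.trans_le hs) (by linarith) (heq s hs))
      ((eventually_half_lt_famQ C).mono fun s hs => by linarith) hτ
  obtain ⟨m, hm, hmQ⟩ : ∃ m > 0, ∀ τ ≥ τ₀, m ≤ famQ C τ := by
    obtain ⟨x, hx, hmin⟩ := isCompact_Icc.exists_isMinOn
      (nonempty_Icc.2 (le_max_left τ₀ t)) (hcont.mono Icc_subset_Ici_self)
    refine ⟨min (famQ C x) (1 / 2), lt_min (hQpos x hx.1) (by norm_num), fun τ hτ => ?_⟩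
    rcases le_total τ (max τ₀ t) with h | h
    · exact (min_le_left _ _).trans (hmin ⟨hτ, h⟩)
    · exact (min_le_right _ _).trans (ht τ ((le_max_right _ _).trans h)).le
  set Q₀ := famQ C τ₀ with hQ₀
  set q₀ := frobQ (-1) τ₀ with hq₀
  have hQ₀pos : 0 < Q₀ := hQpos τ₀ le_rfl
  have hq₀pos : 0 < q₀ := frobQ_neg_one_pos hτ₀
  have hP₀ : famP C τ₀ = u τ₀ * Q₀ := heq τ₀ le_rfl
  have hp₀ : frobP (-1) τ₀ = psi (-1) τ₀ * q₀ := (div_mul_cancel₀ _ hq₀pos.ne').symm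
  set g := u τ₀ - psi (-1) τ₀ with hg
  have hgpos : 0 < g := sub_pos.2 hlt
  -- `Q / q` increases, so `q` is at most a multiple of `Q`
  have hratio : ∀ τ ≥ τ₀, Q₀ * frobQ (-1) τ ≤ q₀ * famQ C τ := by
    intro τ hτ
    have h := hF.div_frobQ_le hτ₀ (by
      rw [hP₀]; exact mul_lt_mul_of_pos_right hlt hQ₀pos) hτ
    rw [div_le_div_iff₀ hq₀pos (frobQ_neg_one_pos (hτ₀.trans_le hτ))] at h
    linarith
  have hW : ∀ τ ≥ τ₀, frobP (-1) τ * famQ C τ - famP C τ * frobQ (-1) τ = -(g * q₀ * Q₀) := by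
    intro τ hτ
    rw [hL.wronskian_eq hF (h2.trans_le hτ) h2, hp₀, hP₀]
    ring
  intro ε hε
  refine ⟨min (g / 4) (ε * m ^ 2 / (8 * Q₀ ^ 2)), lt_min (by positivity) (by positivity),
    fun y hy => ?_⟩
  obtain ⟨hy1, hy2⟩ := lt_min_iff.1 hy
  have hd := abs_lt.1 hy1
  have hden : 0 < y - psi (-1) τ₀ := by linarith
  have hden2 : g / 2 ≤ y - psi (-1) τ₀ := by linarith
  -- the parameter for which the perturbed solution starts at `y`
  set s := Q₀ * (u τ₀ - y) / (q₀ * (y - psi (-1) τ₀)) with hs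
  have hsabs : |s| * (q₀ * g) ≤ 2 * Q₀ * |y - u τ₀| := by
    rw [hs, abs_div, abs_mul, abs_mul, abs_of_pos hQ₀pos, abs_of_pos hq₀pos, abs_of_pos hden,
      abs_sub_comm, div_mul_eq_mul_div, div_le_iff₀ (by positivity)]
    have : 0 ≤ Q₀ * |y - u τ₀| * q₀ := by positivity
    nlinarith
  have hs_le : |s| * q₀ ≤ Q₀ / 2 := by
    have h5 : |s| * q₀ * g ≤ Q₀ / 2 * g := by nlinarith
    exact le_of_mul_le_mul_right h5 hgpos
  have hQs : ∀ τ ≥ τ₀, famQ C τ / 2 ≤ famQ C τ + s * frobQ (-1) τ := by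
    intro τ hτ
    have h5 := hratio τ hτ
    have h6 := frobQ_neg_one_pos (hτ₀.trans_le hτ)
    have h7 : |s| * frobQ (-1) τ ≤ famQ C τ / 2 := by
      have h8 : |s| * frobQ (-1) τ * Q₀ ≤ famQ C τ / 2 * Q₀ := by
        calc |s| * frobQ (-1) τ * Q₀ = |s| * (Q₀ * frobQ (-1) τ) := by ring
          _ ≤ |s| * (q₀ * famQ C τ) := mul_le_mul_of_nonneg_left h5 (abs_nonneg s)
          _ = |s| * q₀ * famQ C τ := by ring
          _ ≤ Q₀ / 2 * famQ C τ := mul_le_mul_of_nonneg_right hs_le (hQpos τ hτ).le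
          _ = _ := by ring
      exact le_of_mul_le_mul_right h8 hQ₀pos
    have h9 := mul_le_mul_of_nonneg_right (neg_abs_le s) h6.le
    linarith
  have hcomb := hF.combine hL 1 s
  refine ⟨fun τ => (1 * famP C τ + s * frobP (-1) τ) / (1 * famQ C τ + s * frobQ (-1) τ),
    hcomb.isSolutionOn_div (Ici_subset_Ioi_two hτ₀) fun τ hτ => ?_, ?_, fun τ hτ => ?_⟩
  · have := hQs τ hτ
    have := hQpos τ hτ
    apply ne_of_gt
    linarith
  · have h5 := hQs τ₀ le_rfl
    rw [← hQ₀, ← hq₀] at h5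
    have h6 : 1 * Q₀ + s * q₀ ≠ 0 := by apply ne_of_gt; linarith
    simp only [← hQ₀, ← hq₀]
    rw [div_eq_iff h6, hP₀, hp₀]
    have h7 : s * (q₀ * (y - psi (-1) τ₀)) = Q₀ * (u τ₀ - y) := by
      rw [hs, div_mul_cancel₀ _ (by positivity)]
    linear_combination -h7
  · have h5 := hQs τ hτ
    have h6 := hQpos τ hτ
    have h7 := hmQ τ hτ
    have h8 : 0 < 1 * famQ C τ + s * frobQ (-1) τ := by linarith
    have h9 : u τ = famP C τ / famQ C τ := by rw [heq τ hτ, mul_div_cancel_right₀ _ h6.ne']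
    have h10 : (1 * famP C τ + s * frobP (-1) τ) / (1 * famQ C τ + s * frobQ (-1) τ) - u τ
        = -(s * (g * q₀ * Q₀)) / ((1 * famQ C τ + s * frobQ (-1) τ) * famQ C τ) := by
      rw [h9, div_sub_div _ _ h8.ne' h6.ne']
      congr 1
      linear_combination s * hW τ hτ
    rw [h10, abs_div, abs_neg, abs_mul, abs_of_pos (by positivity : 0 < g * q₀ * Q₀),
      abs_of_pos (mul_pos h8 h6), div_lt_iff₀ (mul_pos h8 h6)]
    rw [lt_div_iff₀ (by positivity)] at hy2
    calc |s| * (g * q₀ * Q₀) = |s| * (q₀ * g) * Q₀ := by ring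
      _ ≤ 2 * Q₀ * |y - u τ₀| * Q₀ := mul_le_mul_of_nonneg_right hsabs hQ₀pos.le
      _ = |y - u τ₀| * (8 * Q₀ ^ 2) / 4 := by ring
      _ < ε * m ^ 2 / 2 := by nlinarith [mul_pos hε (pow_pos hm 2)]
      _ = ε * (m / 2 * m) := by ring
      _ ≤ ε * ((1 * famQ C τ + s * frobQ (-1) τ) * famQ C τ) := by
        refine mul_le_mul_of_nonneg_left (mul_le_mul ?_ h7 hm.le h8.le) hε.le
        linarith

lemma not_isLyapunovStable_psi {u : ℝ → ℝ} {τ₀ : ℝ} (hτ₀ : 2 * (√2 + 1) < τ₀)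
    (hu : u τ₀ = psi (-1) τ₀) : ¬ IsLyapunovStable u τ₀ := by
  intro h
  obtain ⟨δ, hδ, h⟩ := h 1 one_pos
  obtain ⟨v, hv, hv0, -⟩ := h (u τ₀ - δ / 2) (by
    rw [sub_sub_cancel_left, abs_neg, abs_of_pos (by positivity)]; linarith)
  have := hv.psi_le hτ₀
  linarith

/-! ### The sign of the parameter -/

lemma hasExpansion_psi_one : HasExpansion (psi 1) 0 := by
  refine hasExpansion_of_fam (τ₁ := 2 * (√2 + 1) + 1) fun τ hτ => ?_
  have := frobQ_one_pos (by linarith : 2 * (√2 + 1) < τ)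
  rw [famP, famQ, psi]
  field_simp
  ring

lemma HasExpansion.tendsto_mul_sub_psi {u : ℝ → ℝ} {C : ℝ} (h : HasExpansion u C) :
    Tendsto (fun r : ℝ => r * (u (4 * r ^ 2) - psi 1 (4 * r ^ 2))) atTop (𝓝 C) := by
  have := h.tendsto_mul.sub hasExpansion_psi_one.tendsto_mul
  rw [sub_zero] at this
  refine this.congr fun r => ?_
  ring

lemma lt_psi_one {τ : ℝ} (hτ : 2 * (√2 + 1) < τ) : √2 - 1 < psi 1 τ := by
  simpa using lt_psi (σ := 1) (Or.inl rfl) hτ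

lemma IsSolutionOn.param_eq_zero_iff {u : ℝ → ℝ} {τ₁ C : ℝ} (hτ₁ : 2 * (√2 + 1) < τ₁)
    (hu : IsSolutionOn u (Ici τ₁)) (hC : HasExpansion u C) :
    C = 0 ↔ EqOn u (psi 1) (Ici τ₁) := by
  constructor
  · rintro rfl
    exact hasExpansion_unique_solution (two_lt_of_lt hτ₁) hu (isSolutionOn_psi_Ici (Or.inl rfl) hτ₁)
      hC hasExpansion_psi_one
  · intro h
    refine hC.unique (hasExpansion_psi_one.congr ?_)
    filter_upwards [eventually_ge_atTop τ₁] with τ hτ using (h hτ).symm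

lemma IsSolutionOn.param_neg_iff {u : ℝ → ℝ} {τ₁ C : ℝ} (hτ₁ : 2 * (√2 + 1) < τ₁)
    (hu : IsSolutionOn u (Ici τ₁)) (hC : HasExpansion u C) :
    C < 0 ↔ ∀ᶠ τ in atTop, u τ ≤ √2 - 1 := by
  constructor
  · intro h
    refine eventually_of_comp_four_mul_sq ?_
    filter_upwards [hC.tendsto_mul.eventually_lt_const h, eventually_gt_atTop 0] with r h1 hr
    have := neg_of_mul_neg_right h1 hr.le
    linarith
  · intro h
    refine lt_of_le_of_ne (le_of_tendsto hC.tendsto_mul ?_) fun h0 => ?_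
    · filter_upwards [tendsto_four_mul_sq.eventually h, eventually_gt_atTop 0] with r h1 hr
      exact mul_nonpos_of_nonneg_of_nonpos hr.le (by linarith)
    · obtain ⟨t, ht, ht'⟩ := (h.and (eventually_ge_atTop τ₁)).exists
      rw [(hu.param_eq_zero_iff hτ₁ hC).1 h0 ht'] at ht
      exact absurd ht (not_le.2 (lt_psi_one (hτ₁.trans_le ht')))

lemma IsSolutionOn.param_pos_iff {u : ℝ → ℝ} {τ₁ C : ℝ} (hτ₁ : 2 * (√2 + 1) < τ₁)
    (hu : IsSolutionOn u (Ici τ₁)) (hC : HasExpansion u C) :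
    0 < C ↔ ∀ τ ≥ τ₁, psi 1 τ < u τ := by
  have hpsi := isSolutionOn_psi_Ici (σ := 1) (Or.inl rfl) hτ₁
  constructor
  · intro h τ hτ
    have h1 : ∀ᶠ τ in atTop, psi 1 τ < u τ := by
      refine eventually_of_comp_four_mul_sq ?_
      filter_upwards [hC.tendsto_mul_sub_psi.eventually_const_lt h, eventually_gt_atTop 0]
        with r h1 hr
      have := pos_of_mul_pos_right h1 hr.le
      linarith
    obtain ⟨t, ht, ht'⟩ := (h1.and (eventually_ge_atTop τ₁)).exists
    exact IsSolutionOn.lt_of_lt ordConnected_Ici (Ici_subset_Ioi_two hτ₁) hpsi hu ht' hτ ht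
  · intro h
    refine lt_of_le_of_ne (ge_of_tendsto hC.tendsto_mul_sub_psi ?_) fun h0 => ?_
    · filter_upwards [tendsto_four_mul_sq.eventually (eventually_ge_atTop τ₁),
        eventually_gt_atTop 0] with r h1 hr
      exact mul_nonneg hr.le (by linarith [h _ h1])
    · exact (h τ₁ le_rfl).ne ((hu.param_eq_zero_iff hτ₁ hC).1 h0.symm self_mem_Ici).symm

/-- If `C < 0`, then `tan (π / 8) - u` is of order `1 / r`, much larger than the distance
`O(1 / r²)` of the nullcline from `tan (π / 8)`, so `u` increases eventually. -/
lemma HasExpansion.eventually_rhs_pos {u : ℝ → ℝ} {C : ℝ} (hC : HasExpansion u C) (h : C < 0) :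
    ∀ᶠ τ in atTop, 0 < coeffB τ - coeffA τ * u τ ^ 2 := by
  refine eventually_of_comp_four_mul_sq ?_
  have hi : Tendsto (fun r : ℝ => r⁻¹) atTop (𝓝 0) := tendsto_inv_atTop_zero
  have hu := hC.tendsto.comp tendsto_four_mul_sq
  have hs := lt_sqrt_two
  have h1 := ((hC.tendsto_mul.mul (hu.const_add (√2 - 1))).const_mul (-4 * (√2 + 1))).sub
    (hi.mul (((hu.pow 2).const_mul 2).const_add 2))
  have h2 : 0 < -4 * (√2 + 1) * (C * (√2 - 1 + (√2 - 1))) - 0 * (2 + 2 * (√2 - 1) ^ 2) := by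
    have : 0 < (√2 + 1) * (√2 - 1) := mul_pos (by linarith) (by linarith)
    nlinarith [mul_pos this (neg_pos.2 h)]
  filter_upwards [h1.eventually_const_lt h2, eventually_gt_atTop 0] with r h3 hr
  have hsq := sqrt_two_sq
  have h4 : coeffB (4 * r ^ 2) - coeffA (4 * r ^ 2) * u (4 * r ^ 2) ^ 2 =
      r / (4 * (4 * r ^ 2) * (4 * r ^ 2 + 1)) * (-4 * (√2 + 1) *
        (r * (u (4 * r ^ 2) - (√2 - 1)) * (√2 - 1 + u (4 * r ^ 2))) -
          r⁻¹ * (2 + 2 * u (4 * r ^ 2) ^ 2)) := by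
    rw [coeffA, coeffB]
    field_simp
    linear_combination (4 * r ^ 2 * (1 - √2)) * hsq
  rw [h4]
  exact mul_pos (by positivity) h3

/-- A solution that starts increasing keeps increasing, because `growth` increases. -/
lemma IsSolutionOn.strictMonoOn_of_rhs_pos {u : ℝ → ℝ} {τ₀ : ℝ} (hτ₀ : 2 < τ₀)
    (hu : IsSolutionOn u (Ici τ₀)) (h0 : 0 < coeffB τ₀ - coeffA τ₀ * u τ₀ ^ 2) :
    StrictMonoOn u (Ici τ₀) := by
  obtain ⟨p, q, h, hp, hq⟩ := exists_isLinSol hτ₀ (u τ₀) 1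
  have hq0 : q τ₀ ≠ 0 := by rw [hq]; exact one_ne_zero
  have hJ2 : Ici τ₀ ⊆ Ioi 2 := fun τ hτ => hτ₀.trans_le hτ
  have heq := h.eq_mul_of_isSolutionOn ordConnected_Ici hJ2 hu self_mem_Ici
    (by rw [hp, hq, mul_one])
  refine hu.strictMonoOn ordConnected_Ici fun τ hτ => ?_
  have hτ2 : 2 < τ := hJ2 hτ
  have hqτ := h.snd_ne_zero hτ₀ hτ2 hq0 (heq τ hτ)
  rw [rhs_eq_growth (by linarith) hq0 (heq τ₀ self_mem_Ici)] at h0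
  rw [rhs_eq_growth (by linarith) hqτ (heq τ hτ)]
  have h1 : 0 < growth p q τ₀ := by
    by_contra hneg
    exact absurd h0 (not_lt.2 (div_nonpos_of_nonpos_of_nonneg (not_lt.1 hneg)
      (mul_nonneg (by linarith) (sq_nonneg _))))
  have h2 := (h.strictMonoOn_growth fun t ht =>
    h.sq_add_sq_pos_of_snd_ne_zero hτ₀ ht hq0).monotoneOn hτ₀ hτ2 hτ
  have h3 : 0 < q τ ^ 2 := by positivity
  exact div_pos (by linarith) (mul_pos (by linarith) h3)

/-! ### Solutions in `D₁` and above `ψ₁*` -/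

lemma infinite_increasing_solutions {τ₀ : ℝ} (hτ₀ : 2 * (√2 + 1) < τ₀) :
    {y : ℝ | ∃ u : ℝ → ℝ, IsSolutionOn u (Ici τ₀) ∧ u τ₀ = y ∧
      (∀ τ ≥ τ₀, 0 ≤ u τ ∧ u τ ≤ √2 - 1) ∧ StrictMonoOn u (Ici τ₀) ∧
      Tendsto u atTop (𝓝 (√2 - 1)) ∧ ∃ C < 0, HasExpansion u C}.Infinite := by
  have h2 := two_lt_of_lt hτ₀
  have ha := coeffA_pos (by linarith : 0 < τ₀)
  have hb := coeffB_pos hτ₀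
  -- initial values between zero and the nullcline
  refine (Ioo_infinite (show (0 : ℝ) < √(coeffB τ₀ / coeffA τ₀) from
    Real.sqrt_pos.2 (div_pos hb ha))).mono fun y hy => ?_
  obtain ⟨u, hu, hu0, C, hC⟩ := exists_isSolutionOn_of_psi_lt hτ₀
    ((psi_neg_one_neg hτ₀).trans hy.1)
  have hrhs : 0 < coeffB τ₀ - coeffA τ₀ * u τ₀ ^ 2 := by
    have h3 := (Real.lt_sqrt hy.1.le).1 hy.2
    rw [lt_div_iff₀ ha] at h3
    rw [hu0]
    linarith
  have hmono := hu.strictMonoOn_of_rhs_pos h2 hrhs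
  have hle : ∀ τ ≥ τ₀, u τ ≤ √2 - 1 := fun τ hτ => by
    refine ge_of_tendsto hC.tendsto ?_
    filter_upwards [eventually_ge_atTop τ] with t ht
    exact hmono.monotoneOn hτ (hτ.trans ht) ht
  refine ⟨u, hu, hu0, fun τ hτ => ⟨?_, hle τ hτ⟩, hmono, hC.tendsto, C, ?_, hC⟩
  · have := hmono.monotoneOn self_mem_Ici hτ hτ
    linarith [hy.1]
  · exact (hu.param_neg_iff hτ₀ hC).2 ((eventually_ge_atTop τ₀).mono hle)

lemma infinite_solutions_above_psi {τ₀ : ℝ} (hτ₀ : 2 * (√2 + 1) < τ₀) :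
    {y : ℝ | ∃ u : ℝ → ℝ, IsSolutionOn u (Ici τ₀) ∧ u τ₀ = y ∧ (∀ τ ≥ τ₀, psi 1 τ < u τ) ∧
      Tendsto u atTop (𝓝 (√2 - 1)) ∧ ∃ C > 0, HasExpansion u C}.Infinite := by
  refine (Ioi_infinite (psi 1 τ₀)).mono fun y hy => ?_
  have h1 := lt_psi_one hτ₀
  have h2 := psi_neg_one_neg hτ₀
  have h3 := lt_sqrt_two
  have hy' : psi 1 τ₀ < y := hy
  obtain ⟨u, hu, hu0, C, hC⟩ := exists_isSolutionOn_of_psi_lt hτ₀ (y := y) (by linarith)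
  have hgt : ∀ τ ≥ τ₀, psi 1 τ < u τ := fun τ hτ =>
    IsSolutionOn.lt_of_lt ordConnected_Ici (Ici_subset_Ioi_two hτ₀)
      (isSolutionOn_psi_Ici (Or.inl rfl) hτ₀) hu self_mem_Ici hτ (by rwa [hu0])
  exact ⟨u, hu, hu0, hgt, hC.tendsto, C, (hu.param_pos_iff hτ₀ hC).2 hgt, hC⟩

lemma tendsto_psi_neg_one : Tendsto (psi (-1)) atTop (𝓝 (-(√2 - 1))) := by
  simpa only [neg_one_mul] using tendsto_psi (σ := -1) (Or.inr rfl)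

/-- A global solution that is eventually bounded above by some `c < tan (π / 8)` is `ψ₂`. -/
lemma IsSolutionOn.eqOn_psi_of_eventually_le {u : ℝ → ℝ} {τ₀ c : ℝ} (hτ₀ : 2 * (√2 + 1) < τ₀)
    (hu : IsSolutionOn u (Ici τ₀)) (hc : c < √2 - 1) (h : ∀ᶠ τ in atTop, u τ ≤ c) :
    EqOn u (psi (-1)) (Ici τ₀) := by
  refine (hu.eqOn_psi_or_hasExpansion hτ₀).resolve_right ?_
  rintro ⟨C, hC⟩
  exact absurd (le_of_tendsto hC.tendsto h) (not_le.2 hc)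

lemma IsSolutionOn.not_isLyapunovStable_iff {u : ℝ → ℝ} {τ₀ : ℝ} (hτ₀ : 2 * (√2 + 1) < τ₀)
    (hu : IsSolutionOn u (Ici τ₀)) :
    ¬ IsLyapunovStable u τ₀ ↔ EqOn u (psi (-1)) (Ici τ₀) := by
  refine ⟨fun h => ?_, fun h => not_isLyapunovStable_psi hτ₀ (h self_mem_Ici)⟩
  refine IsSolutionOn.eqOn ordConnected_Ici (Ici_subset_Ioi_two hτ₀) hu
    (isSolutionOn_psi_Ici (Or.inr rfl) hτ₀) self_mem_Ici ?_
  by_contra hne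
  exact h (hu.isLyapunovStable hτ₀ (lt_of_le_of_ne (hu.psi_le hτ₀) (Ne.symm hne)))

end SpiralRiccati

open SpiralRiccati in
theorem mainTheorem2 :
    -- on `(0, 2(√2 + 1))` all solutions decrease
    (∀ (J : Set ℝ) (u : ℝ → ℝ), J.OrdConnected → J ⊆ Ioo 0 (2 * (√2 + 1)) →
      SpiralRiccati.IsSolutionOn u J → StrictAntiOn u J) ∧
    -- every solution tending to `tan (π / 8)` has an expansion, with a unique parameter `C`
    (∀ (τ₁ : ℝ) (u : ℝ → ℝ), 0 < τ₁ → SpiralRiccati.IsSolutionOn u (Ici τ₁) →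
      Tendsto u atTop (𝓝 (Real.tan (Real.pi / 8))) →
      ∃! C : ℝ, SpiralRiccati.HasExpansion u C) ∧
    -- every real `C` occurs, for exactly one solution near infinity
    (∀ C : ℝ, ∃ (τ₁ : ℝ) (u : ℝ → ℝ), 0 < τ₁ ∧ SpiralRiccati.IsSolutionOn u (Ici τ₁) ∧
      SpiralRiccati.HasExpansion u C ∧
      ∀ (τ₂ : ℝ) (v : ℝ → ℝ), 0 < τ₂ → SpiralRiccati.IsSolutionOn v (Ici τ₂) →
        SpiralRiccati.HasExpansion v C → EqOn v u (Ici (max τ₁ τ₂))) ∧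
    ∀ δ₀ > (0 : ℝ), ∀ τ₀ : ℝ, τ₀ = 2 * (√2 + 1) + δ₀ →
      -- through every point there passes a solution with a maximal right interval of existence
      (∀ τ₁ ≥ τ₀, ∀ y : ℝ, ∃ (T : WithTop ℝ) (u : ℝ → ℝ),
        SpiralRiccati.IsMaximalSolution u τ₁ T ∧ u τ₁ = y) ∧
      ∃ ψ₂ ψ₁s : ℝ → ℝ,
        -- the solution `ψ₂`
        SpiralRiccati.IsSolutionOn ψ₂ (Ici τ₀) ∧
        (∀ τ ≥ τ₀, -Real.tan (Real.pi / 8) < ψ₂ τ ∧ ψ₂ τ ≤ 0) ∧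
        Tendsto ψ₂ atTop (𝓝 (-Real.tan (Real.pi / 8))) ∧
        ((fun τ : ℝ => ψ₂ τ - (1 - √2 + 2 * √2 * (√2 - 1) / (3 * τ)))
          =O[atTop] fun τ : ℝ => 1 / τ ^ 2) ∧
        -- `ψ₂` is the unique unstable solution, the unique one with its limit, and the
        -- unique one that stays in `D₂`
        (∀ u : ℝ → ℝ, SpiralRiccati.IsSolutionOn u (Ici τ₀) →
          (¬ SpiralRiccati.IsLyapunovStable u τ₀ ↔ EqOn u ψ₂ (Ici τ₀)) ∧
          (Tendsto u atTop (𝓝 (-Real.tan (Real.pi / 8))) ↔ EqOn u ψ₂ (Ici τ₀)) ∧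
          ((∀ τ ≥ τ₀, -Real.tan (Real.pi / 8) ≤ u τ ∧ u τ ≤ 0) ↔ EqOn u ψ₂ (Ici τ₀))) ∧
        -- solutions above `ψ₂` are global to the right and tend to `tan (π / 8)`
        (∀ τ₁ ≥ τ₀, ∀ (T : WithTop ℝ) (u : ℝ → ℝ),
          SpiralRiccati.IsMaximalSolution u τ₁ T → ψ₂ τ₁ < u τ₁ →
            T = ⊤ ∧ (∀ τ ≥ τ₁, ψ₂ τ < u τ) ∧
            Tendsto u atTop (𝓝 (Real.tan (Real.pi / 8)))) ∧
        -- solutions under `ψ₂` move away from it, decrease, and reach `-∞` at a finite time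
        (∀ τ₁ ≥ τ₀, ∀ (T : WithTop ℝ) (u : ℝ → ℝ),
          SpiralRiccati.IsMaximalSolution u τ₁ T → u τ₁ < ψ₂ τ₁ →
            ∃ t : ℝ, T = (t : WithTop ℝ) ∧
              StrictAntiOn u (Ico τ₁ t) ∧
              StrictMonoOn (fun τ => ψ₂ τ - u τ) (Ico τ₁ t) ∧
              Tendsto u (𝓝[<] t) atBot) ∧
        -- infinitely many growing solutions in `D₁`
        {y : ℝ | ∃ u : ℝ → ℝ, SpiralRiccati.IsSolutionOn u (Ici τ₀) ∧ u τ₀ = y ∧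
          (∀ τ ≥ τ₀, 0 ≤ u τ ∧ u τ ≤ Real.tan (Real.pi / 8)) ∧
          StrictMonoOn u (Ici τ₀) ∧
          Tendsto u atTop (𝓝 (Real.tan (Real.pi / 8))) ∧
          ∃ C < 0, SpiralRiccati.HasExpansion u C}.Infinite ∧
        -- the solution `ψ₁*`
        SpiralRiccati.IsSolutionOn ψ₁s (Ici τ₀) ∧
        (∀ τ ≥ τ₀, Real.tan (Real.pi / 8) < ψ₁s τ) ∧
        StrictAntiOn ψ₁s (Ici τ₀) ∧
        Tendsto ψ₁s atTop (𝓝 (Real.tan (Real.pi / 8))) ∧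
        ((fun τ : ℝ => ψ₁s τ - (√2 - 1 + 2 * √2 * (√2 - 1) / τ))
          =O[atTop] fun τ : ℝ => 1 / τ ^ 2) ∧
        SpiralRiccati.HasExpansion ψ₁s 0 ∧
        -- infinitely many solutions above `ψ₁*`
        {y : ℝ | ∃ u : ℝ → ℝ, SpiralRiccati.IsSolutionOn u (Ici τ₀) ∧ u τ₀ = y ∧
          (∀ τ ≥ τ₀, ψ₁s τ < u τ) ∧
          Tendsto u atTop (𝓝 (Real.tan (Real.pi / 8))) ∧
          ∃ C > 0, SpiralRiccati.HasExpansion u C}.Infinite ∧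
        -- the sign of `C` and the position of the solution determine each other
        (∀ τ₁ ≥ τ₀, ∀ (u : ℝ → ℝ) (C : ℝ), SpiralRiccati.IsSolutionOn u (Ici τ₁) →
          SpiralRiccati.HasExpansion u C →
          (C < 0 ↔ ∃ τ₂ ≥ τ₁, StrictMonoOn u (Ici τ₂) ∧
            ∀ τ ≥ τ₂, 0 ≤ u τ ∧ u τ ≤ Real.tan (Real.pi / 8)) ∧
          (C < 0 ↔ ∃ τ₂ ≥ τ₁, ∀ τ ≥ τ₂, 0 ≤ u τ ∧ u τ ≤ Real.tan (Real.pi / 8)) ∧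
          (C = 0 ↔ EqOn u ψ₁s (Ici τ₁)) ∧
          (0 < C ↔ ∀ τ ≥ τ₁, ψ₁s τ < u τ)) := by
  rw [tan_pi_div_eight]
  have hs := lt_sqrt_two
  refine ⟨?_, ?_, ?_, ?_⟩
  · intro J u hJ hJs hu
    refine hu.strictAntiOn hJ fun τ hτ => ?_
    have h1 := coeffB_neg (hJs hτ).1 (hJs hτ).2
    have h2 := mul_nonneg (coeffA_pos (hJs hτ).1).le (sq_nonneg (u τ))
    linarith
  · intro τ₁ u _ hu hlim
    obtain ⟨C, hC⟩ := hu.exists_hasExpansion hlim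
    exact ⟨C, hC, fun C' hC' => hC'.unique hC⟩
  · intro C
    obtain ⟨τ₁, u, hτ₁, hu, hC⟩ := exists_solution_hasExpansion C
    refine ⟨τ₁, u, by linarith, hu, hC, fun τ₂ v _ hv hvC => ?_⟩
    exact hasExpansion_unique_solution (lt_max_of_lt_left hτ₁)
      (hv.mono (Ici_subset_Ici.2 (le_max_right _ _))) (hu.mono (Ici_subset_Ici.2 (le_max_left _ _)))
      hvC hC
  intro δ₀ hδ₀ τ₀ hτ₀
  replace hτ₀ : 2 * (√2 + 1) < τ₀ := by linarith
  refine ⟨fun τ₁ hτ₁ y => exists_isMaximalSolution (two_lt_of_lt (hτ₀.trans_le hτ₁)) y,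
    psi (-1), psi 1, isSolutionOn_psi_Ici (Or.inr rfl) hτ₀, fun τ hτ => ⟨?_, ?_⟩,
    tendsto_psi_neg_one, ?_, fun u hu => ⟨hu.not_isLyapunovStable_iff hτ₀,
      ⟨fun h => ?_, fun h => ?_⟩, ⟨fun h => ?_, fun h τ hτ => ?_⟩⟩,
    fun τ₁ hτ₁ T u hu hlt => hu.of_psi_lt (hτ₀.trans_le hτ₁) hlt,
    fun τ₁ hτ₁ T u hu hlt => hu.of_lt_psi (hτ₀.trans_le hτ₁) hlt,
    infinite_increasing_solutions hτ₀, isSolutionOn_psi_Ici (Or.inl rfl) hτ₀,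
    fun τ hτ => lt_psi_one (hτ₀.trans_le hτ),
    (strictAntiOn_psi (Or.inl rfl)).mono fun τ hτ => hτ₀.trans_le hτ,
    hasExpansion_psi_one.tendsto, ?_, hasExpansion_psi_one, infinite_solutions_above_psi hτ₀,
    fun τ₁ hτ₁ u C hu hC => ?_⟩
  · simpa only [neg_one_mul] using lt_psi (σ := -1) (Or.inr rfl) (hτ₀.trans_le hτ)
  · exact (psi_neg_one_neg (hτ₀.trans_le hτ)).le
  · refine (psi_isBigO (σ := -1) (Or.inr rfl)).congr (fun τ => ?_) fun τ => by rw [inv_pow, one_div]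
    rw [div_eq_mul_inv _ (3 * τ), mul_inv]
    ring
  · exact hu.eqOn_psi_of_eventually_le hτ₀ (c := 0) (by linarith)
      ((h.eventually_lt_const (by linarith : -(√2 - 1) < 0)).mono fun τ hτ => hτ.le)
  · refine tendsto_psi_neg_one.congr' ?_
    filter_upwards [eventually_ge_atTop τ₀] with τ hτ using (h hτ).symm
  · exact hu.eqOn_psi_of_eventually_le hτ₀ (c := 0) (by linarith)
      ((eventually_ge_atTop τ₀).mono fun τ hτ => (h τ hτ).2)
  · rw [h hτ]
    refine ⟨le_of_lt ?_, (psi_neg_one_neg (hτ₀.trans_le hτ)).le⟩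
    simpa only [neg_one_mul] using lt_psi (σ := -1) (Or.inr rfl) (hτ₀.trans_le hτ)
  · refine (psi_isBigO (σ := 1) (Or.inl rfl)).congr (fun τ => ?_) fun τ => by rw [inv_pow, one_div]
    rw [div_eq_mul_inv _ τ]
    ring
  · have h1 := hτ₀.trans_le hτ₁
    have hneg := hu.param_neg_iff h1 hC
    have hback : (∃ τ₂ ≥ τ₁, ∀ τ ≥ τ₂, 0 ≤ u τ ∧ u τ ≤ √2 - 1) → C < 0 := by
      rintro ⟨τ₂, -, h⟩
      exact hneg.2 ((eventually_ge_atTop τ₂).mono fun τ hτ => (h τ hτ).2)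
    have hforth : C < 0 → ∃ τ₂ ≥ τ₁, StrictMonoOn u (Ici τ₂) ∧
        ∀ τ ≥ τ₂, 0 ≤ u τ ∧ u τ ≤ √2 - 1 := by
      intro h
      obtain ⟨t, ht⟩ := eventually_atTop.1 (((hneg.1 h).and (hC.eventually_rhs_pos h)).and
        (hC.tendsto.eventually_const_lt (by linarith : 0 < √2 - 1)))
      have hsol := hu.mono (Ici_subset_Ici.2 (le_max_left τ₁ t))
      have hmem : ∀ τ ≥ max τ₁ t, t ≤ τ := fun τ hτ => (le_max_right _ _).trans hτ
      exact ⟨max τ₁ t, le_max_left _ _,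
        hsol.strictMonoOn ordConnected_Ici fun τ hτ => (ht τ (hmem τ hτ)).1.2,
        fun τ hτ => ⟨(ht τ (hmem τ hτ)).2.le, (ht τ (hmem τ hτ)).1.1⟩⟩
    exact ⟨⟨hforth, fun ⟨τ₂, h, _, h'⟩ => hback ⟨τ₂, h, h'⟩⟩,
      ⟨fun h => (hforth h).imp fun τ₂ h' => ⟨h'.1, h'.2.2⟩, hback⟩,
      hu.param_eq_zero_iff h1 hC, hu.param_pos_iff h1 hC⟩
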